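/- Let $\mathsf H$ be a complex Hilbert space of finite dimension $n\ge 2$, let $H_0,H_1,\dots,H_m$ ($m\ge 0$) be self-adjoint operators on $\mathsf H$, and consider the quantum control system $$ i\,\dot\psi(t)=\Big(H_0+\sum_{j=1}^m u_j(t)H_j\Big)\psi(t), $$ with real controls $u=(u_1,\dots,u_m)$ from a class $\mathcal U$ that contains all piecewise constant functions with finitely many breakpoints and consists of functions that are locally integrable on $[0,\infty)$. The system is pure state controllable if for all unit vectors $\psi_0,\psi_1\in\mathsf H$ there are $u\in\mathcal U$ and $T>0$ such that the solution with $\psi(0)=\psi_0$ satisfies $\psi(T)=\psi_1$. Identify the projective space $\mathsf P(\mathsf H)$ with the manifold of rank-one orthogonal projectors on $\mathsf H$, with tangent spaces $T_p\mathsf P(\mathsf H)=\{-i[A,p] : A=A^*\}$. For $\kappa>0$ equip it with the symplectic form $\omega_p(-i[A,p],-i[B,p])=-i\kappa\,\mathrm{tr}(p[A,B])$ and the Fubini–Study metric $g_p(u,v)=\kappa\,\mathrm{tr}(p(uv+vu))$. For a self-adjoint operator $A$ let $f_A(p)=\kappa\,\mathrm{tr}(Ap)+\frac{1-\kappa}{n}\mathrm{tr}(A)$,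 with Hamiltonian vector field $X_{f_A}$ given by $\omega(X_{f_A},\cdot)=df_A$. Let $\mathcal C$ be the accessibility algebra, that is, the Lie subalgebra of the Lie algebra of smooth vector fields on $\mathsf P(\mathsf H)$ generated by $X_{f_{H_0}},\dots,X_{f_{H_m}}$; for $p\in\mathsf P(\mathsf H)$ let $\mathfrak A_p$ be the Lie algebra of the Killing vector fields $X$ of $g$ with $X(p)=0$. Let $\mathcal L$ be the real Lie algebra of operators generated by $-iH_0,\dots,-iH_m$, and let $\mathfrak C_p=\{T : T^*=-T,\ [T,ip]=0\}$ be the centralizer of $ip$ in $\mathfrak u(n)$. Then $\mathcal C$ is finite-dimensional, and for every fixed $p\in\mathsf P(\mathsf H)$ the system is pure state controllable if and only if $$\dim\mathcal C-\dim(\mathcal C\cap\mathfrak A_p)=2n-2 .$$ Moreover, this equality holds if and only if $\dim\mathcal L-\dim(\mathcal L\cap\mathfrak C_p)=2n-2$. -/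

import Mathlib

open scoped ContDiff InnerProductSpace

namespace GeometricQM

attribute [local instance] LieRing.ofAssociativeRing

/-! Operators and pure states -/

/-- The (continuous) linear operators on `H`. -/
abbrev Op (H : Type*) [NormedAddCommGroup H] [InnerProductSpace ℂ H] : Type _ := H →L[ℂ] H

section

variable {H : Type*} [NormedAddCommGroup H] [InnerProductSpace ℂ H] [FiniteDimensional ℂ H]

/-- The trace of an operator. -/
noncomputable def tr : Op H →ₗ[ℂ] ℂ :=
  (LinearMap.trace ℂ H) ∘ₗ (ContinuousLinearMap.coeLM ℂ)

theorem tr_mul_comm (A B : Op H) : tr (A * B) = tr (B * A) :=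
  LinearMap.trace_mul_comm ℂ (A : H →ₗ[ℂ] H) (B : H →ₗ[ℂ] H)

/-- The exponential of a skew-adjoint operator is unitary. -/
theorem exp_smul_star {K : Op H} (hK : star K = -K) (t : ℝ) :
    star (NormedSpace.exp (t • K)) = NormedSpace.exp (-(t • K)) := by
  have h := NormedSpace.star_exp (t • K)
  rw [h, star_smul, hK, star_trivial, smul_neg]

theorem exp_neg_mul_exp (K : Op H) :
    NormedSpace.exp (-K) * NormedSpace.exp K = 1 := by
  let _ : NormedAlgebra ℚ (Op H) := NormedAlgebra.restrictScalars ℚ ℂ (Op H)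
  have h := NormedSpace.exp_add_of_commute (x := -K) (y := K) (Commute.neg_left (Commute.refl K))
  rw [← h, neg_add_cancel, NormedSpace.exp_zero]

end

/-- The phase space `P(H)`: the projective space of `H`, each ray being identified with the
rank-one orthogonal projector on it (an orthogonal projector has rank one iff its trace is `1`). -/
def PureState (H : Type*) [NormedAddCommGroup H] [InnerProductSpace ℂ H]
    [FiniteDimensional ℂ H] : Type _ :=
  {p : Op H // IsSelfAdjoint p ∧ p * p = p ∧ tr p = 1}

section

variable {H : Type*} [NormedAddCommGroup H] [InnerProductSpace ℂ H] [FiniteDimensional ℂ H]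

/-- A pure state as a projector. -/
def PureState.op (p : PureState H) : Op H := p.1

/-- The vector `-i[A, p]`. -/
noncomputable def tangentOf (p : PureState H) (A : Op H) : Op H :=
  (-Complex.I) • (A * p.op - p.op * A)

/-- The tangent space of `P(H)` at `p`: all operators `-i[A, p]` with `A` self-adjoint. -/
noncomputable def tangentSpace (p : PureState H) : Submodule ℝ (Op H) where
  carrier := {v | ∃ A : Op H, IsSelfAdjoint A ∧ v = tangentOf p A}
  zero_mem' := ⟨0, IsSelfAdjoint.zero _, by simp [tangentOf]⟩
  add_mem' := by
    rintro _ _ ⟨A, hA, rfl⟩ ⟨B, hB, rfl⟩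
    refine ⟨A + B, hA.add hB, ?_⟩
    simp only [tangentOf, add_mul, mul_add, ← smul_add]
    congr 1
    abel
  smul_mem' := by
    rintro c _ ⟨A, hA, rfl⟩
    refine ⟨c • A, ?_, ?_⟩
    · rw [IsSelfAdjoint, star_smul, hA.star_eq, star_trivial]
    · simp only [tangentOf, smul_mul_assoc, mul_smul_comm, ← smul_sub]
      rw [smul_comm]

theorem mul_tangent_mul {p v : Op H} (hp : p * p = p) (hv : v * p + p * v = v) :
    p * v * p = 0 := by
  have h : p * (v * p + p * v) * p = p * v * p := by rw [hv]
  have h2 : p * (v * p + p * v) * p = p * v * (p * p) + (p * p) * v * p := by noncomm_ring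
  rw [h2, hp] at h
  simpa using h

/-- Tangent vectors at `p` are the self-adjoint `v` with `v p + p v = v`. -/
theorem mem_tangentSpace_iff (p : PureState H) (v : Op H) :
    v ∈ tangentSpace p ↔ IsSelfAdjoint v ∧ v * p.op + p.op * v = v := by
  obtain ⟨p, hp, hpp, -⟩ := p
  constructor
  · rintro ⟨A, hA, rfl⟩
    simp only [tangentOf, PureState.op]
    refine ⟨?_, ?_⟩
    · rw [IsSelfAdjoint, star_smul, star_sub, star_mul, star_mul, hA.star_eq, hp.star_eq,
        ← neg_sub (A * p), smul_neg, ← neg_smul]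
      simp
    · rw [smul_mul_assoc, mul_smul_comm, ← smul_add]
      congr 1
      have : (A * p - p * A) * p + p * (A * p - p * A) = A * (p * p) - (p * p) * A := by
        noncomm_ring
      rw [this, hpp]
  · rintro ⟨hv, hvp⟩
    simp only [PureState.op] at hvp
    refine ⟨Complex.I • (v * p - p * v), ?_, ?_⟩
    · rw [IsSelfAdjoint, star_smul, star_sub, star_mul, star_mul, hv.star_eq, hp.star_eq,
        ← neg_sub (v * p), smul_neg, ← neg_smul]
      simp
    · simp only [tangentOf, PureState.op]
      rw [smul_mul_assoc, mul_smul_comm, ← smul_sub, smul_smul]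
      have h := mul_tangent_mul hpp hvp
      have h2 : (v * p - p * v) * p - p * (v * p - p * v)
          = v * (p * p) + (p * p) * v - 2 • (p * v * p) := by noncomm_ring
      rw [h2, h, hpp, hvp]
      simp

/-- The curve `t ↦ exp(tK) p exp(-tK)` in `P(H)`, with `K = [v, p]`. It starts at `p` with
velocity `v`. -/
noncomputable def curve (p : PureState H) (v : tangentSpace p) (t : ℝ) : PureState H :=
  ⟨NormedSpace.exp (t • ((v : Op H) * p.op - p.op * v)) * p.op *
      NormedSpace.exp (-(t • ((v : Op H) * p.op - p.op * v))), by
    obtain ⟨v, hv⟩ := v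
    rw [mem_tangentSpace_iff] at hv
    obtain ⟨p, hp, hpp, htr⟩ := p
    simp only [PureState.op] at hv ⊢
    have hK : star (v * p - p * v) = -(v * p - p * v) := by
      rw [star_sub, star_mul, star_mul, hv.1.star_eq, hp.star_eq]
      abel
    have h1 := exp_smul_star hK t
    have h2 := exp_neg_mul_exp (t • (v * p - p * v))
    refine ⟨?_, ?_, ?_⟩
    · rw [← h1, IsSelfAdjoint, star_mul, star_mul, star_star, hp.star_eq, mul_assoc]
    · set U := NormedSpace.exp (t • (v * p - p * v))
      set V := NormedSpace.exp (-(t • (v * p - p * v)))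
      have : U * p * V * (U * p * V) = U * p * (V * U) * p * V := by noncomm_ring
      rw [this, h2, mul_one, mul_assoc U p p, hpp]
    · rw [tr_mul_comm, ← mul_assoc, h2, one_mul, htr]⟩

theorem curve_zero (p : PureState H) (v : tangentSpace p) : (curve p v 0).op = p.op := by
  simp [curve, PureState.op]

theorem hasDerivAt_curve (p : PureState H) (v : tangentSpace p) :
    HasDerivAt (fun t : ℝ => (curve p v t).op) (v : Op H) 0 := by
  have hv := v.2
  rw [mem_tangentSpace_iff] at hv
  set K : Op H := (v : Op H) * p.op - p.op * v with hKdef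
  have hpp : p.op * p.op = p.op := p.2.2.1
  have h1 : HasDerivAt (fun t : ℝ => NormedSpace.exp (t • K)) K 0 := by
    simpa using hasDerivAt_exp_smul_const (𝕂 := ℝ) K (0 : ℝ)
  have h2 : HasDerivAt (fun t : ℝ => NormedSpace.exp (-(t • K))) (-K) 0 := by
    simpa using hasDerivAt_exp_smul_const (𝕂 := ℝ) (-K) (0 : ℝ)
  have h3 := (h1.mul_const p.op).mul h2
  have h4 : K * p.op * NormedSpace.exp (-((0 : ℝ) • K)) +
      NormedSpace.exp ((0 : ℝ) • K) * p.op * -K = (v : Op H) := by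
    simp only [zero_smul, neg_zero, NormedSpace.exp_zero, mul_one, one_mul]
    have h := mul_tangent_mul hpp hv.2
    have h5 : K * p.op + p.op * -K =
        (v : Op H) * (p.op * p.op) + (p.op * p.op) * v - 2 • (p.op * v * p.op) := by
      rw [hKdef]; noncomm_ring
    rw [h5, h, hpp, hv.2]
    simp
  rw [h4] at h3
  exact h3

/-! Derivatives, vector fields and their Lie bracket -/

/-- The derivative at `p` of a function on `P(H)` along the tangent vector `v`. -/
noncomputable def dirDeriv {F : Type*} [NormedAddCommGroup F] [NormedSpace ℝ F]
    (f : PureState H → F) (p : PureState H) (v : tangentSpace p) : F :=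
  deriv (fun t : ℝ => f (curve p v t)) 0

/-- For a function with a smooth extension to the space of operators, it is the derivative
of any such extension. -/
theorem dirDeriv_eq {F : Type*} [NormedAddCommGroup F] [NormedSpace ℝ F]
    {f : PureState H → F} {G : Op H → F} (hG : ContDiff ℝ ∞ G) (h : ∀ p, G p.op = f p)
    (p : PureState H) (v : tangentSpace p) : dirDeriv f p v = fderiv ℝ G p.op (v : Op H) := by
  have h1 : HasFDerivAt G (fderiv ℝ G p.op) (curve p v 0).op := by
    rw [curve_zero]
    exact (hG.differentiable (by simp) p.op).hasFDerivAt
  have h2 := h1.comp_hasDerivAt (0 : ℝ) (hasDerivAt_curve p v)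
  have h3 : (fun t : ℝ => f (curve p v t)) = G ∘ fun t : ℝ => (curve p v t).op := by
    funext t
    simp [h]
  rw [dirDeriv, h3]
  exact h2.deriv

end

/-- The real vector space of smooth vector fields on `P(H)`. Smoothness means that there is a
smooth extension to the space of operators, in which `P(H)` is a compact submanifold. -/
noncomputable def SmoothVF (H : Type*) [NormedAddCommGroup H] [InnerProductSpace ℂ H]
    [FiniteDimensional ℂ H] : Submodule ℝ ((p : PureState H) → tangentSpace p) where
  carrier := {X | ∃ F : Op H → Op H, ContDiff ℝ ∞ F ∧ ∀ p, F p.op = (X p : Op H)}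
  zero_mem' := ⟨fun _ => 0, contDiff_const, fun p => by simp⟩
  add_mem' := by
    rintro X Y ⟨F, hF, hFX⟩ ⟨G, hG, hGY⟩
    exact ⟨fun q => F q + G q, hF.add hG, fun p => by simp [hFX, hGY]⟩
  smul_mem' := by
    rintro c X ⟨F, hF, hFX⟩
    exact ⟨fun q => c • F q, hF.const_smul c, fun p => by simp [hFX]⟩

section

variable {H : Type*} [NormedAddCommGroup H] [InnerProductSpace ℂ H] [FiniteDimensional ℂ H]

/-- The value at `p` of a smooth vector field, as an operator. -/
noncomputable def opAt (X : SmoothVF H) (p : PureState H) : Op H := (X.1 p : Op H)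

theorem opAt_ext {X Y : SmoothVF H} (h : ∀ p, opAt X p = opAt Y p) : X = Y :=
  Subtype.ext (funext fun p => Subtype.ext (h p))

/-- The bracket of the extensions is tangent to `P(H)`. -/
theorem lieBracket_mem {X Y : SmoothVF H} {F G : Op H → Op H} (hF : ContDiff ℝ ∞ F)
    (hFX : ∀ p, F p.op = opAt X p) (hG : ContDiff ℝ ∞ G) (hGY : ∀ p, G p.op = opAt Y p)
    (p : PureState H) : VectorField.lieBracket ℝ F G p.op ∈ tangentSpace p := by
  -- derivative of a tangent field in a tangent direction
  have key : ∀ (Z : SmoothVF H) (K : Op H → Op H), ContDiff ℝ ∞ K → (∀ q, K q.op = opAt Z q) →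
      ∀ v : tangentSpace p, IsSelfAdjoint (fderiv ℝ K p.op v) ∧
        fderiv ℝ K p.op v * p.op + K p.op * v + ((v : Op H) * K p.op + p.op * fderiv ℝ K p.op v)
          = fderiv ℝ K p.op v := by
    intro Z K hK hKZ v
    have hc := hasDerivAt_curve p v
    have h1 : HasFDerivAt K (fderiv ℝ K p.op) (curve p v 0).op := by
      rw [curve_zero]
      exact (hK.differentiable (by simp) p.op).hasFDerivAt
    have h2 : HasDerivAt (fun t : ℝ => K (curve p v t).op) (fderiv ℝ K p.op v) 0 :=
      h1.comp_hasDerivAt (0 : ℝ) hc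
    have hmem : ∀ q : PureState H, IsSelfAdjoint (K q.op) ∧
        K q.op * q.op + q.op * K q.op = K q.op := fun q => by
      rw [hKZ, ← mem_tangentSpace_iff]
      exact (Z.1 q).2
    constructor
    · have h3 := h2.star
      have h4 : (fun t : ℝ => star (K (curve p v t).op)) = fun t : ℝ => K (curve p v t).op :=
        funext fun t => (hmem _).1
      rw [h4] at h3
      exact h3.unique h2
    · have h3 := (h2.mul hc).add (hc.mul h2)
      have h4 : ((fun t : ℝ => K (curve p v t).op) * (fun t : ℝ => (curve p v t).op) +
          (fun t : ℝ => (curve p v t).op) * fun t : ℝ => K (curve p v t).op) =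
          fun t : ℝ => K (curve p v t).op := funext fun t => (hmem _).2
      have h5 := (h4 ▸ h3).unique h2
      simpa only [curve_zero] using h5
  obtain ⟨a1, a2⟩ := key Y G hG hGY (X.1 p)
  obtain ⟨b1, b2⟩ := key X F hF hFX (Y.1 p)
  have hX : ((X.1 p : tangentSpace p) : Op H) = F p.op := (hFX p).symm
  have hY : ((Y.1 p : tangentSpace p) : Op H) = G p.op := (hGY p).symm
  rw [hX] at a1 a2
  rw [hY] at b1 b2
  rw [mem_tangentSpace_iff, VectorField.lieBracket_eq]
  refine ⟨a1.sub b1, ?_⟩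
  calc _ = (fderiv ℝ G p.op (F p.op) * p.op + G p.op * F p.op +
          (F p.op * G p.op + p.op * fderiv ℝ G p.op (F p.op))) -
        (fderiv ℝ F p.op (G p.op) * p.op + F p.op * G p.op +
          (G p.op * F p.op + p.op * fderiv ℝ F p.op (G p.op))) := by noncomm_ring
    _ = _ := by rw [a2, b2]

theorem bracket_eq_lieBracket {X Y : SmoothVF H} {F G : Op H → Op H} (hF : ContDiff ℝ ∞ F)
    (hFX : ∀ p, F p.op = opAt X p) (hG : ContDiff ℝ ∞ G) (hGY : ∀ p, G p.op = opAt Y p)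
    (p : PureState H) :
    dirDeriv (opAt Y) p (X.1 p) - dirDeriv (opAt X) p (Y.1 p) = VectorField.lieBracket ℝ F G p.op := by
  rw [dirDeriv_eq hG hGY, dirDeriv_eq hF hFX, VectorField.lieBracket_eq]
  simp only [hFX, hGY]
  rfl

/-- The Lie bracket of smooth vector fields: the derivative of `Y` along `X` minus the
derivative of `X` along `Y`. -/
noncomputable instance : Bracket (SmoothVF H) (SmoothVF H) where
  bracket X Y := ⟨fun p => ⟨dirDeriv (opAt Y) p (X.1 p) - dirDeriv (opAt X) p (Y.1 p), by
      obtain ⟨F, hF, hFX⟩ := X.2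
      obtain ⟨G, hG, hGY⟩ := Y.2
      rw [bracket_eq_lieBracket hF hFX hG hGY]
      exact lieBracket_mem hF hFX hG hGY p⟩, by
    obtain ⟨F, hF, hFX⟩ := X.2
    obtain ⟨G, hG, hGY⟩ := Y.2
    exact ⟨VectorField.lieBracket ℝ F G, hF.lieBracket_vectorField hG (by simp),
      fun p => (bracket_eq_lieBracket hF hFX hG hGY p).symm⟩⟩

theorem bracket_val (X Y : SmoothVF H) (p : PureState H) :
    opAt ⁅X, Y⁆ p = dirDeriv (opAt Y) p (X.1 p) - dirDeriv (opAt X) p (Y.1 p) := rfl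

theorem bracket_val_eq {X Y : SmoothVF H} {F G : Op H → Op H} (hF : ContDiff ℝ ∞ F)
    (hFX : ∀ p, F p.op = opAt X p) (hG : ContDiff ℝ ∞ G) (hGY : ∀ p, G p.op = opAt Y p)
    (p : PureState H) : opAt ⁅X, Y⁆ p = VectorField.lieBracket ℝ F G p.op := by
  rw [bracket_val, bracket_eq_lieBracket hF hFX hG hGY]

theorem exists_ext (X : SmoothVF H) :
    ∃ F : Op H → Op H, ContDiff ℝ ∞ F ∧ ∀ p, F p.op = opAt X p := X.2

theorem opAt_add (X Y : SmoothVF H) (p : PureState H) :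
    opAt (X + Y) p = opAt X p + opAt Y p := rfl

theorem opAt_smul (c : ℝ) (X : SmoothVF H) (p : PureState H) :
    opAt (c • X) p = c • opAt X p := rfl

theorem opAt_zero (p : PureState H) : opAt (0 : SmoothVF H) p = 0 := rfl

/-- Smooth vector fields form a Lie ring. -/
noncomputable instance : LieRing (SmoothVF H) where
  add_lie X Y Z := opAt_ext fun p => by
    obtain ⟨F, hF, hFX⟩ := (exists_ext X)
    obtain ⟨G, hG, hGY⟩ := (exists_ext Y)
    obtain ⟨K, hK, hKZ⟩ := (exists_ext Z)
    rw [opAt_add, bracket_val_eq hF hFX hK hKZ, bracket_val_eq hG hGY hK hKZ,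
      bracket_val_eq (F := F + G) (hF.add hG)
        (fun q => by rw [opAt_add, ← hFX, ← hGY]; rfl) hK hKZ]
    exact VectorField.lieBracket_add_left (hF.differentiable (by simp) _)
      (hG.differentiable (by simp) _)
  lie_add X Y Z := opAt_ext fun p => by
    obtain ⟨F, hF, hFX⟩ := (exists_ext X)
    obtain ⟨G, hG, hGY⟩ := (exists_ext Y)
    obtain ⟨K, hK, hKZ⟩ := (exists_ext Z)
    rw [opAt_add, bracket_val_eq hF hFX hG hGY, bracket_val_eq hF hFX hK hKZ,
      bracket_val_eq (G := G + K) hF hFX (hG.add hK)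
        (fun q => by rw [opAt_add, ← hGY, ← hKZ]; rfl)]
    exact VectorField.lieBracket_add_right (hG.differentiable (by simp) _)
      (hK.differentiable (by simp) _)
  lie_self X := opAt_ext fun p => by
    rw [bracket_val, sub_self, opAt_zero]
  leibniz_lie X Y Z := opAt_ext fun p => by
    obtain ⟨F, hF, hFX⟩ := (exists_ext X)
    obtain ⟨G, hG, hGY⟩ := (exists_ext Y)
    obtain ⟨K, hK, hKZ⟩ := (exists_ext Z)
    have hs : ∀ {A B : Op H → Op H}, ContDiff ℝ ∞ A → ContDiff ℝ ∞ B →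
        ContDiff ℝ ∞ (VectorField.lieBracket ℝ A B) :=
      fun hA hB => hA.lieBracket_vectorField hB (by simp)
    rw [opAt_add,
      bracket_val_eq hF hFX (hs hG hK) (fun q => (bracket_val_eq hG hGY hK hKZ q).symm),
      bracket_val_eq (hs hF hG) (fun q => (bracket_val_eq hF hFX hG hGY q).symm) hK hKZ,
      bracket_val_eq hG hGY (hs hF hK) (fun q => (bracket_val_eq hF hFX hK hKZ q).symm)]
    exact VectorField.leibniz_identity_lieBracket (n := ∞)
      (by rw [minSmoothness_of_isRCLikeNormedField]; exact WithTop.coe_le_coe.2 le_top) hF.contDiffAt hG.contDiffAt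
      hK.contDiffAt

/-- Smooth vector fields form a real Lie algebra. -/
noncomputable instance : LieAlgebra ℝ (SmoothVF H) where
  lie_smul c X Y := opAt_ext fun p => by
    obtain ⟨F, hF, hFX⟩ := (exists_ext X)
    obtain ⟨G, hG, hGY⟩ := (exists_ext Y)
    rw [opAt_smul, bracket_val_eq hF hFX hG hGY,
      bracket_val_eq (G := c • G) hF hFX (contDiff_const.smul hG)
        (fun q => by rw [opAt_smul, ← hGY]; rfl)]
    exact VectorField.lieBracket_const_smul_right (hG.differentiable (by simp) _)

/-- The bracket acts on smooth functions as the commutator of derivations. -/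
theorem dirDeriv_bracket {f : PureState H → ℝ} {φ : Op H → ℝ} (hφ : ContDiff ℝ ∞ φ)
    (h : ∀ p, φ p.op = f p) (X Y : SmoothVF H) (p : PureState H) :
    dirDeriv f p ((⁅X, Y⁆ : SmoothVF H).1 p) =
      dirDeriv (fun q => dirDeriv f q (Y.1 q)) p (X.1 p) -
        dirDeriv (fun q => dirDeriv f q (X.1 q)) p (Y.1 p) := by
  obtain ⟨F, hF, hFX⟩ := (exists_ext X)
  obtain ⟨G, hG, hGY⟩ := (exists_ext Y)
  have hs : ∀ {A : Op H → Op H}, ContDiff ℝ ∞ A → ContDiff ℝ ∞ fun q => fderiv ℝ φ q (A q) :=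
    fun hA => (hφ.fderiv_right (m := ∞) (by simp)).clm_apply hA
  rw [dirDeriv_eq hφ h,
    dirDeriv_eq (hs hG) (fun q => by rw [dirDeriv_eq hφ h, hGY]; rfl),
    dirDeriv_eq (hs hF) (fun q => by rw [dirDeriv_eq hφ h, hFX]; rfl)]
  have h1 := VectorField.fderiv_apply_lieBracket (𝕜 := ℝ) (n := ∞) (f := φ) (V := F) (W := G)
    (x := p.op) hφ.contDiffAt
    (by rw [minSmoothness_of_isRCLikeNormedField]; exact WithTop.coe_le_coe.2 le_top) (hG.differentiable (by simp) _)
    (hF.differentiable (by simp) _)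
  have h2 : (((⁅X, Y⁆ : SmoothVF H).1 p : tangentSpace p) : Op H) =
    VectorField.lieBracket ℝ F G p.op := bracket_val_eq hF hFX hG hGY p
  have hX : ((X.1 p : tangentSpace p) : Op H) = F p.op := (hFX p).symm
  have hY : ((Y.1 p : tangentSpace p) : Op H) = G p.op := (hGY p).symm
  rw [h2, hX, hY, h1]

/-! Symplectic form, Fubini-Study metric, Hamiltonian and Killing vector fields -/

/-- The symplectic form `ω_p(u, v) = -iκ tr(p [u, v])`; for `u = -i[A, p]` and `v = -i[B, p]`
this is `-iκ tr(p [A, B])`, see `symplecticForm_tangentOf`. -/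
noncomputable def symplecticForm (κ : ℝ) (p : PureState H) (u v : tangentSpace p) : ℝ :=
  (-Complex.I * κ * tr (p.op * ((u : Op H) * (v : Op H) - (v : Op H) * (u : Op H)))).re

/-- The Fubini-Study metric `g_p(u, v) = κ tr(p (u v + v u))`; for `u = -i[A, p]` and
`v = -i[B, p]`
this is `-κ tr(p ([A, p][B, p] + [B, p][A, p]))`, see `fubiniStudy_tangentOf`. -/
noncomputable def fubiniStudy (κ : ℝ) (p : PureState H) (u v : tangentSpace p) : ℝ :=
  (κ * tr (p.op * ((u : Op H) * (v : Op H) + (v : Op H) * (u : Op H)))).re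

/-- The classical-like observable `f_A(p) = κ tr(A p) + ((1 - κ)/n) tr(A)`. -/
noncomputable def observable (κ : ℝ) (A : Op H) (p : PureState H) : ℝ :=
  (κ * tr (A * p.op) + (1 - κ) / (Module.finrank ℂ H) * tr A).re

/-- `X` is the Hamiltonian vector field of `f`: `ω_p(X_p, v) = df_p(v)` for all `p` and `v`. -/
def IsHamiltonianVF (κ : ℝ) (f : PureState H → ℝ) (X : SmoothVF H) : Prop :=
  ∀ (p : PureState H) (v : tangentSpace p), symplecticForm κ p (X.1 p) v = dirDeriv f p v

/-- `X` is a Killing field: the Lie derivative along `X` of the Fubini-Study metric vanishes. -/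
def IsKilling (κ : ℝ) (X : SmoothVF H) : Prop :=
  ∀ (Y Z : SmoothVF H) (p : PureState H),
    dirDeriv (fun q => fubiniStudy κ q (Y.1 q) (Z.1 q)) p (X.1 p) =
      fubiniStudy κ p ((⁅X, Y⁆ : SmoothVF H).1 p) (Z.1 p) +
        fubiniStudy κ p (Y.1 p) ((⁅X, Z⁆ : SmoothVF H).1 p)

theorem tangentOf_mul (p : PureState H) (A B : Op H) :
    tangentOf p A * tangentOf p B = -((A * p.op - p.op * A) * (B * p.op - p.op * B)) := by
  have hI : -Complex.I * -Complex.I = -1 := by simp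
  rw [tangentOf, tangentOf, smul_mul_smul_comm, hI, neg_smul, one_smul]

/-- The symplectic form in terms of representatives of the tangent vectors. -/
theorem symplecticForm_tangentOf (κ : ℝ) (p : PureState H) (u v : tangentSpace p) (A B : Op H)
    (hu : (u : Op H) = tangentOf p A) (hv : (v : Op H) = tangentOf p B) :
    symplecticForm κ p u v = (-Complex.I * κ * tr (p.op * (A * B - B * A))).re := by
  have hpp : p.op * p.op = p.op := p.2.2.1
  have key : ∀ A B : Op H, tr (p.op * (tangentOf p A * tangentOf p B)) =
      tr (p.op * (A * B)) - tr ((p.op * A) * (p.op * B)) := by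
    intro A B
    rw [tangentOf_mul]
    have e : p.op * -((A * p.op - p.op * A) * (B * p.op - p.op * B)) =
        (p.op * p.op) * (A * B) * p.op - p.op * A * p.op * B * p.op
          - (p.op * p.op) * A * (p.op * B) + (p.op * A) * ((p.op * p.op) * B) := by noncomm_ring
    have e1 : tr (p.op * (A * B) * p.op) = tr (p.op * (A * B)) := by
      rw [tr_mul_comm, ← mul_assoc, hpp]
    have e2 : tr (p.op * A * p.op * B * p.op) = tr ((p.op * A) * (p.op * B)) := by
      rw [tr_mul_comm, ← mul_assoc, ← mul_assoc, ← mul_assoc, hpp, mul_assoc (p.op * A)]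
    rw [e, hpp, map_add, map_sub, map_sub, e1, e2]
    ring
  rw [symplecticForm, hu, hv, mul_sub, mul_sub, map_sub, map_sub, key, key,
    tr_mul_comm (p.op * B) (p.op * A)]
  congr 2
  ring

/-- The Fubini-Study metric in terms of representatives of the tangent vectors. -/
theorem fubiniStudy_tangentOf (κ : ℝ) (p : PureState H) (u v : tangentSpace p) (A B : Op H)
    (hu : (u : Op H) = tangentOf p A) (hv : (v : Op H) = tangentOf p B) :
    fubiniStudy κ p u v = (-κ * tr (p.op * ((A * p.op - p.op * A) * (B * p.op - p.op * B) +
      (B * p.op - p.op * B) * (A * p.op - p.op * A)))).re := by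
  rw [fubiniStudy, hu, hv, tangentOf_mul, tangentOf_mul, ← neg_add, mul_neg, map_neg, mul_neg,
    neg_mul]

theorem fubiniStudy_exists_ext (κ : ℝ) (Y Z : SmoothVF H) :
    ∃ φ : Op H → ℝ, ContDiff ℝ ∞ φ ∧ ∀ q, φ q.op = fubiniStudy κ q (Y.1 q) (Z.1 q) := by
  obtain ⟨G, hG, hGY⟩ := (exists_ext Y)
  obtain ⟨K, hK, hKZ⟩ := (exists_ext Z)
  let τ : Op H →L[ℝ] ℝ := LinearMap.toContinuousLinearMap
    (Complex.reLm ∘ₗ (((κ : ℂ) • (tr : Op H →ₗ[ℂ] ℂ)).restrictScalars ℝ))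
  refine ⟨fun q => τ (q * (G q * K q + K q * G q)),
    τ.contDiff.comp (contDiff_id.mul ((hG.mul hK).add (hK.mul hG))), fun q => ?_⟩
  have hY : ((Y.1 q : tangentSpace q) : Op H) = G q.op := (hGY q).symm
  have hZ : ((Z.1 q : tangentSpace q) : Op H) = K q.op := (hKZ q).symm
  rw [fubiniStudy, hY, hZ]
  rfl

theorem fubiniStudy_add_left (κ : ℝ) (p : PureState H) (u u' v : tangentSpace p) :
    fubiniStudy κ p (u + u') v = fubiniStudy κ p u v + fubiniStudy κ p u' v := by
  simp only [fubiniStudy, Submodule.coe_add, add_mul, mul_add, map_add, Complex.add_re]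
  ring

theorem fubiniStudy_comm (κ : ℝ) (p : PureState H) (u v : tangentSpace p) :
    fubiniStudy κ p u v = fubiniStudy κ p v u := by
  simp only [fubiniStudy, add_comm]

theorem fubiniStudy_smul_left (κ c : ℝ) (p : PureState H) (u v : tangentSpace p) :
    fubiniStudy κ p (c • u) v = c * fubiniStudy κ p u v := by
  simp only [fubiniStudy, Submodule.coe_smul, smul_mul_assoc, mul_smul_comm, ← smul_add]
  rw [← Complex.coe_smul, map_smul, smul_eq_mul, ← mul_assoc, mul_comm (κ : ℂ) c, mul_assoc,
    Complex.re_ofReal_mul]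

theorem dirDeriv_add_vec {F : Type*} [NormedAddCommGroup F] [NormedSpace ℝ F]
    {f : PureState H → F} {φ : Op H → F} (hφ : ContDiff ℝ ∞ φ) (h : ∀ p, φ p.op = f p)
    (p : PureState H) (u v : tangentSpace p) :
    dirDeriv f p (u + v) = dirDeriv f p u + dirDeriv f p v := by
  simp only [dirDeriv_eq hφ h, Submodule.coe_add, map_add]

theorem dirDeriv_smul_vec {F : Type*} [NormedAddCommGroup F] [NormedSpace ℝ F]
    {f : PureState H → F} {φ : Op H → F} (hφ : ContDiff ℝ ∞ φ) (h : ∀ p, φ p.op = f p)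
    (p : PureState H) (c : ℝ) (v : tangentSpace p) :
    dirDeriv f p (c • v) = c • dirDeriv f p v := by
  simp only [dirDeriv_eq hφ h, Submodule.coe_smul, map_smul]

theorem dirDeriv_add_fun {f g : PureState H → ℝ} {φ ψ : Op H → ℝ} (hφ : ContDiff ℝ ∞ φ)
    (h : ∀ p, φ p.op = f p) (hψ : ContDiff ℝ ∞ ψ) (h' : ∀ p, ψ p.op = g p)
    (p : PureState H) (v : tangentSpace p) :
    dirDeriv (fun q => f q + g q) p v = dirDeriv f p v + dirDeriv g p v := by
  rw [dirDeriv_eq hφ h, dirDeriv_eq hψ h',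
    dirDeriv_eq (G := fun q => φ q + ψ q) (hφ.add hψ) (fun q => by rw [h, h']),
    fderiv_fun_add (hφ.differentiable (by simp) _) (hψ.differentiable (by simp) _)]
  rfl

theorem IsKilling.bracket {κ : ℝ} {X X' : SmoothVF H} (hX : IsKilling κ X)
    (hX' : IsKilling κ X') : IsKilling κ ⁅X, X'⁆ := by
  intro Y Z p
  obtain ⟨φ, hφ, h⟩ := fubiniStudy_exists_ext κ Y Z
  have e1 : ∀ W W' : SmoothVF H, IsKilling κ W → IsKilling κ W' →
      dirDeriv (fun q => dirDeriv (fun q => fubiniStudy κ q (Y.1 q) (Z.1 q)) q (W'.1 q)) p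
        (W.1 p) =
      fubiniStudy κ p ((⁅W, ⁅W', Y⁆⁆ : SmoothVF H).1 p) (Z.1 p) +
      fubiniStudy κ p ((⁅W', Y⁆ : SmoothVF H).1 p) ((⁅W, Z⁆ : SmoothVF H).1 p) +
      (fubiniStudy κ p ((⁅W, Y⁆ : SmoothVF H).1 p) ((⁅W', Z⁆ : SmoothVF H).1 p) +
      fubiniStudy κ p (Y.1 p) ((⁅W, ⁅W', Z⁆⁆ : SmoothVF H).1 p)) := by
    intro W W' hW hW'
    obtain ⟨φ1, hφ1, h1⟩ := fubiniStudy_exists_ext κ ⁅W', Y⁆ Z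
    obtain ⟨φ2, hφ2, h2⟩ := fubiniStudy_exists_ext κ Y ⁅W', Z⁆
    rw [funext (hW' Y Z), dirDeriv_add_fun hφ1 h1 hφ2 h2, hW ⁅W', Y⁆ Z p, hW Y ⁅W', Z⁆ p]
  rw [dirDeriv_bracket hφ h, e1 X X' hX hX', e1 X' X hX' hX]
  have j1 : (⁅X, ⁅X', Y⁆⁆ : SmoothVF H).1 p =
      (⁅⁅X, X'⁆, Y⁆ : SmoothVF H).1 p + (⁅X', ⁅X, Y⁆⁆ : SmoothVF H).1 p := by
    rw [leibniz_lie X X' Y]; rfl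
  have j2 : (⁅X, ⁅X', Z⁆⁆ : SmoothVF H).1 p =
      (⁅⁅X, X'⁆, Z⁆ : SmoothVF H).1 p + (⁅X', ⁅X, Z⁆⁆ : SmoothVF H).1 p := by
    rw [leibniz_lie X X' Z]; rfl
  rw [j1, j2, fubiniStudy_add_left, fubiniStudy_comm κ p (Y.1 p) (_ + _), fubiniStudy_add_left,
    fubiniStudy_comm κ p _ (Y.1 p), fubiniStudy_comm κ p _ (Y.1 p)]
  ring

end

/-- The Lie algebra of Killing vector fields on `P(H)`. -/
noncomputable def killingAlgebra (H : Type*) [NormedAddCommGroup H] [InnerProductSpace ℂ H]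
    [FiniteDimensional ℂ H] (κ : ℝ) : LieSubalgebra ℝ (SmoothVF H) where
  carrier := {X | IsKilling κ X}
  zero_mem' Y Z p := by
    obtain ⟨φ, hφ, h⟩ := fubiniStudy_exists_ext κ Y Z
    have e0 := dirDeriv_smul_vec hφ h p 0 0
    have e1 := fubiniStudy_smul_left κ 0 p 0 (Z.1 p)
    have e2 := fubiniStudy_smul_left κ 0 p 0 (Y.1 p)
    rw [zero_smul, zero_smul] at e0
    rw [zero_smul, zero_mul] at e1 e2
    simp only [zero_lie]
    rw [fubiniStudy_comm κ p (Y.1 p)]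
    change dirDeriv _ p 0 = fubiniStudy κ p 0 (Z.1 p) + fubiniStudy κ p 0 (Y.1 p)
    rw [e0, e1, e2, add_zero]
  add_mem' {X X'} hX hX' Y Z p := by
    obtain ⟨φ, hφ, h⟩ := fubiniStudy_exists_ext κ Y Z
    simp only [add_lie]
    change dirDeriv _ p (X.1 p + X'.1 p) =
      fubiniStudy κ p ((⁅X, Y⁆ : SmoothVF H).1 p + (⁅X', Y⁆ : SmoothVF H).1 p) (Z.1 p) +
      fubiniStudy κ p (Y.1 p) ((⁅X, Z⁆ : SmoothVF H).1 p + (⁅X', Z⁆ : SmoothVF H).1 p)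
    rw [dirDeriv_add_vec hφ h, hX Y Z p, hX' Y Z p, fubiniStudy_add_left,
      fubiniStudy_comm κ p (Y.1 p) (_ + _), fubiniStudy_add_left, fubiniStudy_comm κ p (Y.1 p),
      fubiniStudy_comm κ p (Y.1 p)]
    ring
  smul_mem' c {X} hX Y Z p := by
    obtain ⟨φ, hφ, h⟩ := fubiniStudy_exists_ext κ Y Z
    simp only [smul_lie]
    change dirDeriv _ p (c • X.1 p) =
      fubiniStudy κ p (c • (⁅X, Y⁆ : SmoothVF H).1 p) (Z.1 p) +
      fubiniStudy κ p (Y.1 p) (c • (⁅X, Z⁆ : SmoothVF H).1 p)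
    rw [dirDeriv_smul_vec hφ h, hX Y Z p, fubiniStudy_smul_left,
      fubiniStudy_comm κ p (Y.1 p) (c • _), fubiniStudy_smul_left, fubiniStudy_comm κ p (Y.1 p),
      smul_eq_mul]
    ring
  lie_mem' hX hX' := IsKilling.bracket hX hX'

section

variable {H : Type*} [NormedAddCommGroup H] [InnerProductSpace ℂ H] [FiniteDimensional ℂ H]

theorem bracket_apply_eq_zero {X Y : SmoothVF H} {p : PureState H} (hX : X.1 p = 0)
    (hY : Y.1 p = 0) : (⁅X, Y⁆ : SmoothVF H).1 p = 0 := by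
  obtain ⟨F, hF, hFX⟩ := (exists_ext X)
  obtain ⟨G, hG, hGY⟩ := (exists_ext Y)
  apply Subtype.ext
  have h := bracket_val_eq hF hFX hG hGY p
  rw [VectorField.lieBracket_eq_zero_of_eq_zero (by rw [hFX, opAt, hX]; rfl)
    (by rw [hGY, opAt, hY]; rfl)] at h
  exact h

/-- The Lie algebra `A_p` of the Killing vector fields that vanish at `p`. -/
noncomputable def vanishingKilling (κ : ℝ) (p : PureState H) : LieSubalgebra ℝ (SmoothVF H) where
  carrier := {X | X ∈ killingAlgebra H κ ∧ X.1 p = 0}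
  zero_mem' := ⟨zero_mem _, rfl⟩
  add_mem' {X Y} hX hY := ⟨add_mem hX.1 hY.1, by
    change X.1 p + Y.1 p = 0
    rw [hX.2, hY.2, add_zero]⟩
  smul_mem' c {X} hX := ⟨(killingAlgebra H κ).smul_mem c hX.1, by
    change c • X.1 p = 0
    rw [hX.2, smul_zero]⟩
  lie_mem' {_ _} hX hY :=
    ⟨(killingAlgebra H κ).lie_mem hX.1 hY.1, bracket_apply_eq_zero hX.2 hY.2⟩

/-- The accessibility algebra: the Lie subalgebra of the smooth vector fields on `P(H)` generated
by the Hamiltonian vector fields of the observables `f_{H₀}, f_{H₁}, …, f_{H_m}`. -/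
noncomputable def accessibilityAlgebra (κ : ℝ) {m : ℕ} (H₀ : Op H) (Hc : Fin m → Op H) :
    LieSubalgebra ℝ (SmoothVF H) :=
  LieSubalgebra.lieSpan ℝ (SmoothVF H)
    {X | IsHamiltonianVF κ (observable κ H₀) X ∨
      ∃ j, IsHamiltonianVF κ (observable κ (Hc j)) X}

/-- The dynamical Lie algebra: the real Lie algebra of operators generated by
`-iH₀, -iH₁, …, -iH_m`. -/
noncomputable def dynamicalAlgebra {m : ℕ} (H₀ : Op H) (Hc : Fin m → Op H) :
    LieSubalgebra ℝ (Op H) :=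
  LieSubalgebra.lieSpan ℝ (Op H)
    (insert ((-Complex.I) • H₀) (Set.range fun j => (-Complex.I) • Hc j))

/-- The centralizer of `ip` in the Lie algebra `u(n)` of skew-adjoint operators. -/
noncomputable def centralizerOf (p : PureState H) : LieSubalgebra ℝ (Op H) where
  carrier := {T | star T = -T ∧ ⁅T, Complex.I • p.op⁆ = 0}
  zero_mem' := ⟨by simp, zero_lie _⟩
  add_mem' {S T} hS hT := ⟨by rw [star_add, hS.1, hT.1, neg_add],
    by rw [add_lie, hS.2, hT.2, add_zero]⟩
  smul_mem' c {T} hT := ⟨by rw [star_smul, hT.1, star_trivial, smul_neg],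
    by rw [smul_lie, hT.2, smul_zero]⟩
  lie_mem' {S T} hS hT := ⟨by
      rw [Ring.lie_def, star_sub, star_mul, star_mul, hS.1, hT.1]; noncomm_ring,
    by rw [lie_lie, hS.2, hT.2, lie_zero, lie_zero, sub_zero]⟩

/-! Controllability -/

/-- `ψ` solves on `[0, T]` the Schrödinger equation `i ψ' = (H₀ + ∑ⱼ uⱼ Hⱼ) ψ` (in integrated
form, so that the controls need only be integrable). -/
def IsSchrodingerSolution {m : ℕ} (H₀ : Op H) (Hc : Fin m → Op H) (u : ℝ → Fin m → ℝ) (T : ℝ)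
    (ψ : ℝ → H) : Prop :=
  ContinuousOn ψ (Set.Icc 0 T) ∧ ∀ t ∈ Set.Icc 0 T,
    ψ t = ψ 0 + ∫ s in (0 : ℝ)..t, (-Complex.I) • (H₀ + ∑ j, u s j • Hc j) (ψ s)

/-- Pure state controllability with controls in the class `𝒰`. -/
def PureStateControllable {m : ℕ} (𝒰 : Set (ℝ → Fin m → ℝ)) (H₀ : Op H) (Hc : Fin m → Op H) :
    Prop :=
  ∀ ψ₀ ψ₁ : H, ‖ψ₀‖ = 1 → ‖ψ₁‖ = 1 → ∃ u ∈ 𝒰, ∃ T : ℝ, 0 < T ∧ ∃ ψ : ℝ → H,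
    IsSchrodingerSolution H₀ Hc u T ψ ∧ ψ 0 = ψ₀ ∧ ψ T = ψ₁

/-- Piecewise constant with finitely many breakpoints. -/
def IsPiecewiseConstant {m : ℕ} (u : ℝ → Fin m → ℝ) : Prop :=
  ∃ B : Finset ℝ, ∀ s t : ℝ, s ≤ t → (∀ b ∈ B, b ∉ Set.Icc s t) → u s = u t

end

end GeometricQM

namespace GeometricQM

set_option linter.unusedSectionVars false

attribute [local instance] LieRing.ofAssociativeRing

open InnerProductSpace (rankOne)

/-! ### The trace form -/

section TraceForm

variable {H : Type*} [NormedAddCommGroup H] [InnerProductSpace ℂ H] [FiniteDimensional ℂ H]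

/-! For a skew-adjoint `T` the field `q ↦ [T, q]` on the pure states is Killing, and for `T = -iA`
it is the unique Hamiltonian field of `f_A`. Hence the accessibility algebra is the image of the
dynamical algebra `L` under `linField`. Evaluation at `p` maps it onto the space of all `[T, p]`
with `T ∈ L`, and its kernel is the intersection with `A_p`; the map `T ↦ [T, p]` on `L` has the
same image and kernel `L ∩ C_p`. By rank-nullity both differences of dimensions equal the dimension
of that image. The tangent space has real dimension `2n - 2`, so the criterion says that `L` moves
the ray of `ψ`, where `p = |ψ⟩⟨ψ|`, in all directions. It remains to compare this with
controllability.

The tool for both implications is the projection `Φ` onto `L + iL`, orthogonal for the trace form.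
Put `D = Φ(|ψ⟩⟨ψ|)`. If `L` moves the ray in all directions, then `ψ` is an eigenvector of `D` with
nonzero eigenvalue, so `iD ∈ L` supplies the missing phase direction and `L` spans the tangent space
of the sphere (`IsRayTransitiveAt.exists_apply_eq`). Controllability then follows with forward times
only: the conjugates of the generators by evolutions span a space containing `L`, a single evolution
attains all these directions, openness gives a ball in the orbit, Poincaré recurrence brings it back
to the starting vector, and connectedness of the sphere finishes
(`exists_apply_eq_of_isSphereTransitiveAt`).

Conversely, the purity `tr(Φ(|x⟩⟨x|)²)` is constant along solutions, so controllability makes it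
constant on the unit sphere. Differentiation and polarization of this identity show that `L` either
moves every ray in all directions or consists of scalars (`isRayTransitiveAt_or_scalar`). Scalars
preserve `|⟨ψ, x⟩|`, which rules out the second case when `n ≥ 2`. -/

theorem inner_star_apply (A : Op H) (a b : H) : inner ℂ a (star A b) = inner ℂ (A a) b :=
  ContinuousLinearMap.adjoint_inner_right A a b

theorem inner_apply_eq_star (A : Op H) (a b : H) : inner ℂ a (A b) = inner ℂ (star A a) b := by
  rw [← inner_star_apply, star_star]

theorem inner_apply_of_isSelfAdjoint {A : Op H} (hA : IsSelfAdjoint A) (a b : H) :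
    inner ℂ a (A b) = inner ℂ (A a) b := by
  rw [inner_apply_eq_star, hA.star_eq]

theorem inner_apply_of_star_eq_neg {A : Op H} (hA : star A = -A) (a b : H) :
    inner ℂ a (A b) = -inner ℂ (A a) b := by
  rw [inner_apply_eq_star, hA, _root_.neg_apply, inner_neg_left]

theorem tr_rankOne (a b : H) : tr (rankOne ℂ a b) = inner ℂ b a :=
  InnerProductSpace.trace_rankOne a b

theorem mul_rankOne (A : Op H) (a b : H) : A * rankOne ℂ a b = rankOne ℂ (A a) b :=
  InnerProductSpace.comp_rankOne a b A

theorem rankOne_mul (A : Op H) (a b : H) : rankOne ℂ a b * A = rankOne ℂ a (star A b) :=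
  InnerProductSpace.rankOne_comp a b A

theorem star_rankOne (a b : H) : star (rankOne ℂ a b : Op H) = rankOne ℂ b a :=
  InnerProductSpace.adjoint_rankOne a b

theorem tr_mul_rankOne (A : Op H) (a b : H) : tr (A * rankOne ℂ a b) = inner ℂ b (A a) := by
  rw [mul_rankOne, tr_rankOne]

theorem tr_star (A : Op H) : tr (star A) = starRingEnd ℂ (tr A) := by
  have h : ∀ B : Op H, tr B = ∑ i, inner ℂ (stdOrthonormalBasis ℂ H i)
      (B (stdOrthonormalBasis ℂ H i)) := fun B =>
    LinearMap.trace_eq_sum_inner _ (stdOrthonormalBasis ℂ H)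
  rw [h, h, map_sum]
  exact Finset.sum_congr rfl fun i _ => by rw [inner_star_apply, inner_conj_symm]

theorem eq_zero_of_tr_star_mul_self_eq_zero {A : Op H} (h : tr (star A * A) = 0) : A = 0 := by
  have h1 : tr (star A * A) = ((∑ i, ‖A (stdOrthonormalBasis ℂ H i)‖ ^ 2 : ℝ) : ℂ) := by
    refine (LinearMap.trace_eq_sum_inner _ (stdOrthonormalBasis ℂ H)).trans ?_
    push_cast
    refine Finset.sum_congr rfl fun i _ => ?_
    change inner ℂ _ (star A (A _)) = _
    rw [inner_star_apply, inner_self_eq_norm_sq_to_K]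
    rfl
  rw [h1, Complex.ofReal_eq_zero, Finset.sum_eq_zero_iff_of_nonneg fun i _ => by positivity] at h
  refine ContinuousLinearMap.coe_injective ((stdOrthonormalBasis ℂ H).toBasis.ext fun i => ?_)
  simpa using h i (Finset.mem_univ i)

theorem isSelfAdjoint_eq_zero_of_tr_mul_self {A : Op H} (hA : IsSelfAdjoint A)
    (h : tr (A * A) = 0) : A = 0 :=
  eq_zero_of_tr_star_mul_self_eq_zero (by rwa [hA.star_eq])

/-- `Φ` is the orthogonal projection onto `M` with respect to the trace form. -/
structure IsTraceProjection (M : Submodule ℂ (Op H)) (Φ : Op H →ₗ[ℂ] Op H) : Prop where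
  star_mem : ∀ X ∈ M, star X ∈ M
  mem : ∀ X, Φ X ∈ M
  tr_mul : ∀ X, ∀ Y ∈ M, tr (Φ X * Y) = tr (X * Y)

/-- The form `tr(XY)` is nondegenerate on `M`: `X` pairs with `X* ∈ M` to `tr(XX*)`, which vanishes
only for `X = 0`. So `M` is its own dual, and `Φ X` is the element representing the functional `tr(X
·)` on `M`. -/
theorem exists_isTraceProjection (M : Submodule ℂ (Op H)) (hM : ∀ X ∈ M, star X ∈ M) :
    ∃ Φ, IsTraceProjection M Φ := by
  let β : Op H →ₗ[ℂ] Op H →ₗ[ℂ] ℂ := (LinearMap.mul ℂ (Op H)).compr₂ tr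
  have hinj : Function.Injective (β.domRestrict₁₂ M M) := by
    rw [← LinearMap.ker_eq_bot, LinearMap.ker_eq_bot']
    intro X hX
    have h := LinearMap.congr_fun hX ⟨star X.1, hM _ X.2⟩
    have h2 : tr (X.1 * star X.1) = 0 := h
    rw [tr_mul_comm] at h2
    exact Subtype.ext (eq_zero_of_tr_star_mul_self_eq_zero h2)
  let e : M ≃ₗ[ℂ] Module.Dual ℂ M :=
    LinearEquiv.ofInjectiveOfFinrankEq (β.domRestrict₁₂ M M) hinj Subspace.dual_finrank_eq.symm
  let Ψ : Op H →ₗ[ℂ] M := e.symm.toLinearMap ∘ₗ β.domRestrict₁₂ ⊤ M ∘ₗ Submodule.topEquiv.symm.toLinearMap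
  refine ⟨M.subtype ∘ₗ Ψ, hM, fun X => (Ψ X).2, fun X Y hY => ?_⟩
  have h : e (Ψ X) = β.domRestrict₁₂ ⊤ M ⟨X, trivial⟩ := e.apply_symm_apply _
  exact LinearMap.congr_fun h ⟨Y, hY⟩

namespace IsTraceProjection

variable {M : Submodule ℂ (Op H)} {Φ : Op H →ₗ[ℂ] Op H}

theorem eq_of_tr_mul (h : IsTraceProjection M Φ) {X Y : Op H} (hX : X ∈ M) (hY : Y ∈ M)
    (hXY : ∀ Z ∈ M, tr (X * Z) = tr (Y * Z)) : X = Y := by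
  refine sub_eq_zero.1 (eq_zero_of_tr_star_mul_self_eq_zero ?_)
  rw [tr_mul_comm, sub_mul, map_sub, hXY _ (h.star_mem _ (sub_mem hX hY)), sub_self]

theorem map_star (h : IsTraceProjection M Φ) (X : Op H) : Φ (star X) = star (Φ X) := by
  refine h.eq_of_tr_mul (h.mem _) (h.star_mem _ (h.mem _)) fun Z hZ => ?_
  rw [h.tr_mul _ _ hZ, ← star_star Z, ← star_mul, ← star_mul, tr_star, tr_star,
    tr_mul_comm _ X, tr_mul_comm _ (Φ X), h.tr_mul _ _ (h.star_mem _ hZ)]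

theorem isSelfAdjoint_rankOne (h : IsTraceProjection M Φ) (a : H) :
    IsSelfAdjoint (Φ (rankOne ℂ a a)) := by
  rw [IsSelfAdjoint, ← h.map_star, star_rankOne]

theorem tr_mul_symm (h : IsTraceProjection M Φ) (X Y : Op H) :
    tr (Φ X * Y) = tr (X * Φ Y) := by
  rw [← h.tr_mul X _ (h.mem Y), tr_mul_comm, ← h.tr_mul Y _ (h.mem X), tr_mul_comm]

/-- This identity lets a vanishing expectation of `Φ(|a⟩⟨a|)` at `a` force the projection itself to
vanish. -/
theorem tr_mul_self (h : IsTraceProjection M Φ) (a : H) :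
    tr (Φ (rankOne ℂ a a) * Φ (rankOne ℂ a a)) = inner ℂ a (Φ (rankOne ℂ a a) a) := by
  rw [h.tr_mul _ _ (h.mem _), tr_mul_comm, tr_mul_rankOne]

/-- The projection is the state as seen by `M`: vectors with the same projection have the same
expectations on `M`. -/
theorem inner_eq_tr (h : IsTraceProjection M Φ) (a : H) {Y : Op H} (hY : Y ∈ M) :
    inner ℂ a (Y a) = tr (Φ (rankOne ℂ a a) * Y) := by
  rw [h.tr_mul _ _ hY, tr_mul_comm, tr_mul_rankOne]

end IsTraceProjection

/-- The complexification `L + iL`. -/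
def complexification (L : LieSubalgebra ℝ (Op H)) : Submodule ℂ (Op H) where
  carrier := {X | ∃ S ∈ L, ∃ T ∈ L, X = S + Complex.I • T}
  zero_mem' := ⟨0, zero_mem _, 0, zero_mem _, by simp⟩
  add_mem' := by
    rintro _ _ ⟨S, hS, T, hT, rfl⟩ ⟨S', hS', T', hT', rfl⟩
    exact ⟨S + S', add_mem hS hS', T + T', add_mem hT hT', by rw [smul_add]; abel⟩
  smul_mem' := by
    rintro c _ ⟨S, hS, T, hT, rfl⟩
    refine ⟨c.re • S - c.im • T, sub_mem (L.smul_mem _ hS) (L.smul_mem _ hT),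
      c.im • S + c.re • T, add_mem (L.smul_mem _ hS) (L.smul_mem _ hT), ?_⟩
    conv_lhs => rw [← Complex.re_add_im c]
    simp only [← Complex.coe_smul]
    match_scalars
    · ring
    · linear_combination (c.im : ℂ) * Complex.I_mul_I

theorem mem_complexification {L : LieSubalgebra ℝ (Op H)} {T : Op H} (hT : T ∈ L) :
    T ∈ complexification L := ⟨T, hT, 0, zero_mem _, by simp⟩

variable {L : LieSubalgebra ℝ (Op H)}

theorem star_mem_complexification (hL : ∀ T ∈ L, star T = -T) :
    ∀ X ∈ complexification L, star X ∈ complexification L := by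
  rintro _ ⟨S, hS, T, hT, rfl⟩
  refine ⟨-S, neg_mem hS, T, hT, ?_⟩
  rw [star_add, star_smul, hL S hS, hL T hT]
  simp

theorem commutator_mem_complexification {X Y : Op H} (hX : X ∈ complexification L)
    (hY : Y ∈ complexification L) : X * Y - Y * X ∈ complexification L := by
  obtain ⟨S, hS, T, hT, rfl⟩ := hX
  obtain ⟨S', hS', T', hT', rfl⟩ := hY
  have hb : ∀ {A B : Op H}, A ∈ L → B ∈ L → A * B - B * A ∈ complexification L := fun hA hB =>
    mem_complexification (L.lie_mem hA hB)
  have e : (S + Complex.I • T) * (S' + Complex.I • T') - (S' + Complex.I • T') * (S + Complex.I • T)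
      = (S * S' - S' * S) + Complex.I • (S * T' - T' * S) + Complex.I • (T * S' - S' * T)
        + Complex.I • Complex.I • (T * T' - T' * T) := by
    simp only [mul_add, add_mul, smul_mul_assoc, mul_smul_comm, smul_sub, smul_add]
    abel
  rw [e]
  exact add_mem (add_mem (add_mem (hb hS hS') (Submodule.smul_mem _ _ (hb hS hT')))
    (Submodule.smul_mem _ _ (hb hT hS')))
    (Submodule.smul_mem _ _ (Submodule.smul_mem _ _ (hb hT hT')))

/-- In `S + iT` the first term is skew-adjoint and the second self-adjoint, so skew-adjointness of
the sum kills `T`. -/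
theorem mem_of_mem_complexification (hL : ∀ T ∈ L, star T = -T) {X : Op H}
    (hX : X ∈ complexification L) (h : star X = -X) : X ∈ L := by
  obtain ⟨S, hS, T, hT, rfl⟩ := hX
  rw [star_add, star_smul, hL S hS, hL T hT] at h
  have h1 : (2 * Complex.I) • T = 0 := by
    have h2 : -S + star Complex.I • -T - -(S + Complex.I • T) = (2 * Complex.I) • T := by
      rw [Complex.star_def, Complex.conj_I]
      module
    rw [← h2, h, sub_self]
  have h3 : T = 0 := (smul_eq_zero.1 h1).resolve_left (by simp)
  simpa [h3] using hS

end TraceForm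

/-! ### Infinitesimal transitivity on the projective space and on the sphere -/

section Transitivity

variable {H : Type*} [NormedAddCommGroup H] [InnerProductSpace ℂ H] [FiniteDimensional ℂ H]

/-- `L` moves the ray of `ψ` in all directions. -/
def IsRayTransitiveAt (L : LieSubalgebra ℝ (Op H)) (ψ : H) : Prop :=
  ∀ v, inner ℂ ψ v = 0 → ∃ T ∈ L, ∃ r : ℝ, T ψ = v + (r * Complex.I) • ψ

variable {L : LieSubalgebra ℝ (Op H)}

theorem inner_commutator_apply (hL : ∀ T ∈ L, star T = -T) {S T : Op H} (hS : S ∈ L)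
    (hT : T ∈ L) (x : H) :
    inner ℂ x ((S * T - T * S) x) = inner ℂ (T x) (S x) - inner ℂ (S x) (T x) := by
  change inner ℂ x (S (T x) - T (S x)) = _
  rw [inner_sub_right, inner_apply_of_star_eq_neg (hL S hS) x, inner_apply_of_star_eq_neg (hL T hT) x]
  ring

theorem inner_commutator_apply_of_isSelfAdjoint (hL : ∀ T ∈ L, star T = -T) {B T : Op H}
    (hB : IsSelfAdjoint B) (hT : T ∈ L) (x : H) :
    inner ℂ x ((B * T - T * B) x) = ((2 * (inner ℂ (B x) (T x)).re : ℝ) : ℂ) := by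
  change inner ℂ x (B (T x) - T (B x)) = _
  rw [inner_sub_right, inner_apply_of_isSelfAdjoint hB x, inner_apply_of_star_eq_neg (hL T hT) x,
    ← inner_conj_symm (T x), sub_neg_eq_add, Complex.add_conj]

theorem exists_real_eq_inner_apply {B : Op H} (hB : IsSelfAdjoint B) (x : H) :
    inner ℂ x (B x) = ((inner ℂ x (B x)).re : ℂ) := by
  refine (Complex.conj_eq_iff_re.1 ?_).symm
  rw [inner_conj_symm, ← inner_apply_of_isSelfAdjoint hB]

/-- With `B = Φ(|x⟩⟨x|)`, the expectation of `[B, T]` at `x` is `2 Re⟨Bx, Tx⟩`; it is also `tr(B[B,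
T])`, which is zero by cyclicity. Up to a factor this is the derivative of the purity along `T`. -/
theorem re_inner_projection_apply (hL : ∀ T ∈ L, star T = -T) {Φ : Op H →ₗ[ℂ] Op H}
    (hΦ : IsTraceProjection (complexification L) Φ) {T : Op H} (hT : T ∈ L) (x : H) :
    (inner ℂ (Φ (rankOne ℂ x x) x) (T x)).re = 0 := by
  set B := Φ (rankOne ℂ x x) with hBdef
  have h1 := inner_commutator_apply_of_isSelfAdjoint hL (hΦ.isSelfAdjoint_rankOne x) hT x
  rw [hΦ.inner_eq_tr x (commutator_mem_complexification (hΦ.mem _) (mem_complexification hT)),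
    ← hBdef, mul_sub, map_sub, ← mul_assoc B T B, tr_mul_comm (B * T) B, sub_self] at h1
  have h2 := congrArg Complex.re h1
  rw [Complex.ofReal_re, Complex.zero_re] at h2
  linarith

theorem decompose_unit {ψ : H} (hψ : ‖ψ‖ = 1) (x : H) :
    inner ℂ ψ (x - inner ℂ ψ x • ψ) = 0 := by
  rw [inner_sub_right, inner_smul_right, inner_self_eq_norm_sq_to_K, hψ]
  simp

/-- A Lie algebra that moves the ray of a unit vector in all directions moves the vector in all
directions tangent to the sphere. -/
theorem IsRayTransitiveAt.exists_apply_eq (hL : ∀ T ∈ L, star T = -T) {ψ : H} (hψ : ‖ψ‖ = 1)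
    (hdim : ∃ v, inner ℂ ψ v = 0 ∧ v ≠ 0) (h : IsRayTransitiveAt L ψ) {v : H}
    (hv : (inner ℂ ψ v).re = 0) : ∃ T ∈ L, T ψ = v := by
  obtain ⟨Φ, hΦ⟩ := exists_isTraceProjection _ (star_mem_complexification hL)
  have hsa := hΦ.isSelfAdjoint_rankOne ψ
  have hψψ : inner ℂ ψ ψ = 1 := by rw [inner_self_eq_norm_sq_to_K, hψ]; simp
  set D := Φ (rankOne ℂ ψ ψ) with hD
  obtain ⟨a, ha⟩ : ∃ a : ℝ, inner ℂ ψ (D ψ) = a := ⟨_, exists_real_eq_inner_apply hsa ψ⟩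
  -- Some `S ∈ L` moves `ψ` along the component `w` of `Dψ` orthogonal to `ψ`, up to phase. Then
  -- `Re⟨Dψ, Sψ⟩ = ‖w‖²`, because `a` is real, and this number is zero.
  have hDψ : D ψ = (a : ℂ) • ψ := by
    set w := D ψ - (a : ℂ) • ψ with hw
    have hwψ : inner ℂ ψ w = 0 := by
      rw [hw, ← ha]
      exact decompose_unit hψ (D ψ)
    obtain ⟨S, hS, r, hSr⟩ := h w hwψ
    have h1 := re_inner_projection_apply hL hΦ hS ψ
    have h2 : D ψ = (a : ℂ) • ψ + w := by rw [hw]; abel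
    have hwψ' : inner ℂ w ψ = 0 := by rw [← inner_conj_symm, hwψ, map_zero]
    rw [← hD, h2, hSr, inner_add_left, inner_add_right, inner_add_right, inner_smul_left,
      inner_smul_left, inner_smul_right, inner_smul_right, hwψ, hwψ', hψψ,
      inner_self_eq_norm_sq_to_K] at h1
    have h3 : ‖w‖ ^ 2 = 0 := by
      simpa [← Complex.ofReal_pow] using h1
    have h4 : w = 0 := by simpa using h3
    rw [h2, h4, add_zero]
  -- If `a = 0` then `D = 0`, and every element of `L + iL` has expectation zero at `ψ`. But the
  -- commutator of elements moving `ψ` along `iv` and along `v` has expectation `2i‖v‖²`.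
  have ha0 : a ≠ 0 := by
    rintro rfl
    have hD0 : D = 0 := isSelfAdjoint_eq_zero_of_tr_mul_self hsa (by
      rw [hD, hΦ.tr_mul_self, ← hD, ha, Complex.ofReal_zero])
    obtain ⟨v, hv, hv0⟩ := hdim
    obtain ⟨T, hT, r, hTr⟩ := h v hv
    obtain ⟨S, hS, s, hSs⟩ := h (Complex.I • v) (by rw [inner_smul_right, hv, mul_zero])
    have h1 := inner_commutator_apply hL hS hT ψ
    have hv' : inner ℂ v ψ = 0 := by rw [← inner_conj_symm, hv, map_zero]
    rw [hΦ.inner_eq_tr ψ (commutator_mem_complexification (mem_complexification hS)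
      (mem_complexification hT)), ← hD, hD0, zero_mul, map_zero, hTr, hSs] at h1
    simp only [inner_add_left, inner_add_right, inner_smul_left, inner_smul_right, hv, hv', hψψ,
      inner_self_eq_norm_sq_to_K] at h1
    have h2 := congrArg Complex.im h1
    simp [← Complex.ofReal_pow] at h2
    have h3 : ‖v‖ ^ 2 = 0 := by linarith
    exact hv0 (by simpa using h3)
  have hID : Complex.I • D ∈ L := mem_of_mem_complexification hL
    (Submodule.smul_mem _ _ (hΦ.mem _)) (by
      rw [star_smul, hsa.star_eq, Complex.star_def, Complex.conj_I, neg_smul])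
  obtain ⟨T, hT, r, hTr⟩ := h _ (decompose_unit hψ v)
  have him : inner ℂ ψ v = ((inner ℂ ψ v).im : ℂ) * Complex.I := by
    conv_lhs => rw [← Complex.re_add_im (inner ℂ ψ v), hv]
    simp
  -- `iD` multiplies `ψ` by `ia`; the coefficient replaces the uncontrolled phase `r` by the
  -- required one.
  refine ⟨T + (((inner ℂ ψ v).im - r) / a) • (Complex.I • D),
    add_mem hT (L.smul_mem _ hID), ?_⟩
  change T ψ + (((inner ℂ ψ v).im - r) / a) • (Complex.I • D ψ) = v
  rw [hTr, hDψ, ← Complex.coe_smul, smul_smul, smul_smul]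
  have e : ((((inner ℂ ψ v).im - r) / a : ℝ) : ℂ) * (Complex.I * a) =
      inner ℂ ψ v - r * Complex.I := by
    have : (a : ℂ) ≠ 0 := by exact_mod_cast ha0
    rw [him]
    push_cast
    simp
    field_simp
  rw [mul_assoc, e]
  module

/-- Polarization of a cubic identity. -/
theorem projection_polarization {Φ : Op H →ₗ[ℂ] Op H} {c : ℂ}
    (h : ∀ x, Φ (rankOne ℂ x x) x = (c * inner ℂ x x) • x) (a b d : H) :
    Φ (rankOne ℂ a b) a = (c * inner ℂ b a) • a ∧
    Φ (rankOne ℂ a b) d + Φ (rankOne ℂ d b) a = (c * inner ℂ b d) • a + (c * inner ℂ b a) • d := by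
  have h1 : ∀ a, Φ (rankOne ℂ a b) a = (c * inner ℂ b a) • a := by
    -- The substitution `a + λb` is weighted by `λ` for the four roots `λ⁴ = 1`. Only the term
    -- antilinear in `b` survives, with factor `4`.
    intro a
    have k1 := h (a + b)
    have k2 := h (a - b)
    have k3 := h (a + Complex.I • b)
    have k4 := h (a - Complex.I • b)
    simp only [map_add, map_sub, map_smul, _root_.add_apply, _root_.sub_apply, _root_.smul_apply,
      map_smulₛₗ, Complex.conj_I, inner_add_left, inner_add_right, inner_sub_left, inner_sub_right,
      inner_smul_left, inner_smul_right] at k1 k2 k3 k4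
    have e4 : (4 : ℂ) • Φ (rankOne ℂ a b) a = (4 : ℂ) • (c * inner ℂ b a) • a := by
      linear_combination (norm := skip) k1 - k2 + Complex.I • k3 - Complex.I • k4
      match_scalars <;> ring_nf <;> (try simp only [Complex.I_sq, Complex.I_pow_four]) <;> (try ring)
    exact smul_right_injective _ (by norm_num : (4 : ℂ) ≠ 0) e4
  refine ⟨h1 a, ?_⟩
  have h2 := h1 (a + d)
  simp only [map_add, _root_.add_apply, inner_add_right, h1 a, h1 d] at h2
  linear_combination (norm := module) h2

end Transitivity

/-! ### Constant purity -/

section Purity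

variable {H : Type*} [NormedAddCommGroup H] [InnerProductSpace ℂ H] [FiniteDimensional ℂ H]

variable {M : Submodule ℂ (Op H)} {Φ : Op H →ₗ[ℂ] Op H}

/-- By homogeneity the hypothesis fixes the quadratic form on all vectors, and over `ℂ` the
quadratic form determines the operator. -/
theorem eq_smul_one_of_inner_apply_self {A : Op H} {c : ℂ}
    (h : ∀ x, ‖x‖ = 1 → inner ℂ x (A x) = c) : A = c • 1 := by
  have key : ∀ x, inner ℂ (A x) x = inner ℂ ((c • (1 : Op H)) x) x := by
    intro x
    rcases eq_or_ne x 0 with rfl | hx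
    · simp
    have hn : (‖x‖ : ℂ) ≠ 0 := by simpa using hx
    have h1 := h (((‖x‖⁻¹ : ℝ) : ℂ) • x) (by
      rw [norm_smul, Complex.norm_real, norm_inv, norm_norm, inv_mul_cancel₀ (by simpa using hx)])
    rw [map_smul, inner_smul_left, inner_smul_right, Complex.conj_ofReal] at h1
    push_cast at h1
    have h2 : inner ℂ x (A x) = c * ‖x‖ ^ 2 := by
      rw [← h1]
      field_simp
    rw [← inner_conj_symm, h2]
    change _ = inner ℂ (c • x) x
    rw [inner_smul_left, inner_self_eq_norm_sq_to_K]
    simp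
  exact ContinuousLinearMap.coe_injective
    ((ext_inner_map (A : H →ₗ[ℂ] H) ((c • (1 : Op H) : Op H) : H →ₗ[ℂ] H)).1 key)

namespace IsTraceProjection

/-- If two distinct eigenvectors share their projection, the projection is scalar. -/
theorem apply_eq_of_eigenvector (hΦ : IsTraceProjection M Φ)
    (hM : ∀ X ∈ M, ∀ Y ∈ M, X * Y - Y * X ∈ M) {c : ℝ}
    (h : ∀ x, Φ (rankOne ℂ x x) x = ((c : ℂ) * inner ℂ x x) • x) {ψ φ : H} (hψ : ‖ψ‖ = 1)
    (hφ : ‖φ‖ = 1) (hψφ : inner ℂ ψ φ = 0) (hD : Φ (rankOne ℂ ψ ψ) φ = (c : ℂ) • φ) (θ : H) :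
    Φ (rankOne ℂ ψ ψ) θ = (c : ℂ) • θ := by
  have pol := fun a b d => (projection_polarization h a b d).2
  have pol1 := fun a b => (projection_polarization h a b 0).1
  have unit : ∀ {x : H}, ‖x‖ = 1 → inner ℂ x x = 1 := fun hx => by
    rw [inner_self_eq_norm_sq_to_K, hx]; simp
  have hφψ : inner ℂ φ ψ = 0 := by rw [← inner_conj_symm, hψφ, map_zero]
  have hDψ : Φ (rankOne ℂ ψ ψ) ψ = (c : ℂ) • ψ := by rw [h, unit hψ, mul_one]
  -- the two projections agree
  have hDD : Φ (rankOne ℂ ψ ψ) = Φ (rankOne ℂ φ φ) := by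
    refine sub_eq_zero.1 (isSelfAdjoint_eq_zero_of_tr_mul_self
      ((hΦ.isSelfAdjoint_rankOne ψ).sub (hΦ.isSelfAdjoint_rankOne φ)) ?_)
    -- The two squares and the mixed products all have trace `c`, so the square of the difference
    -- has trace zero.
    have e1 : tr (Φ (rankOne ℂ ψ ψ) * Φ (rankOne ℂ φ φ)) = c := by
      rw [tr_mul_comm, ← hΦ.inner_eq_tr φ (hΦ.mem _), hD, inner_smul_right, unit hφ, mul_one]
    have e2 : ∀ x : H, ‖x‖ = 1 → tr (Φ (rankOne ℂ x x) * Φ (rankOne ℂ x x)) = c := fun x hx => by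
      rw [hΦ.tr_mul_self, h, unit hx, mul_one, inner_smul_right, unit hx, mul_one]
    rw [sub_mul, mul_sub, mul_sub, map_sub, map_sub, map_sub, e2 ψ hψ, e2 φ hφ, e1, tr_mul_comm,
      e1]
    ring
  suffices hθ : ∀ θ, inner ℂ ψ θ = 0 → Φ (rankOne ℂ ψ ψ) θ = (c : ℂ) • θ by
    have h1 := hθ _ (decompose_unit hψ θ)
    rw [map_sub, map_smul, hDψ, smul_sub, smul_comm (c : ℂ)] at h1
    exact sub_left_injective h1
  intro θ hθ
  have hθψ : inner ℂ θ ψ = 0 := by rw [← inner_conj_symm, hθ, map_zero]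
  -- Polarization gives `Nψ = cθ - Dθ`, so the goal is `Nψ = 0`. Since `ψ` and `φ` have the same
  -- projection, `[N*, N]` has the same expectation at both. As `N*ψ = 0` and `Nφ = 0`, this reads
  -- `‖Nψ‖² = -‖N*φ‖²`.
  set N := Φ (rankOne ℂ θ ψ) with hN
  have hNψ : N ψ = (c : ℂ) • θ - Φ (rankOne ℂ ψ ψ) θ := by
    rw [eq_sub_iff_add_eq, add_comm]
    have h1 := pol ψ ψ θ
    rwa [unit hψ, hθ, mul_zero, zero_smul, zero_add, mul_one] at h1
  have hsN : star N = Φ (rankOne ℂ ψ θ) := by rw [hN, ← hΦ.map_star, star_rankOne]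
  have hNsψ : star N ψ = 0 := by rw [hsN, pol1, hθψ, mul_zero, zero_smul]
  have hφψ0 : Φ (rankOne ℂ φ ψ) = 0 := by
    refine eq_zero_of_tr_star_mul_self_eq_zero ?_
    have h1 := pol ψ ψ φ
    rw [hD, hψφ, unit hψ] at h1
    have h2 : Φ (rankOne ℂ φ ψ) ψ = 0 := by simpa using h1
    rw [tr_mul_comm, hΦ.tr_mul _ _ (hΦ.star_mem _ (hΦ.mem _)), ← hΦ.map_star, star_rankOne,
      ← hΦ.tr_mul_symm, tr_mul_rankOne, h2, inner_zero_right]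
  have hNφ : N φ = 0 := by
    simpa [hψφ, hθ, hφψ0] using pol θ ψ φ
  have hcomm := hM _ (hΦ.star_mem _ (hΦ.mem (rankOne ℂ θ ψ))) _ (hΦ.mem (rankOne ℂ θ ψ))
  rw [← hN] at hcomm
  have hval : ∀ x : H, inner ℂ x ((star N * N - N * star N) x) =
      ((‖N x‖ ^ 2 - ‖star N x‖ ^ 2 : ℝ) : ℂ) := fun x => by
    change inner ℂ x (star N (N x) - N (star N x)) = _
    rw [inner_sub_right, inner_star_apply, inner_apply_eq_star N x, inner_self_eq_norm_sq_to_K,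
      inner_self_eq_norm_sq_to_K]
    push_cast
    rfl
  have h1 : (‖N ψ‖ ^ 2 - ‖star N ψ‖ ^ 2 : ℝ) = ‖N φ‖ ^ 2 - ‖star N φ‖ ^ 2 := by
    have h2 := hval ψ
    rw [hΦ.inner_eq_tr ψ hcomm, hDD, ← hΦ.inner_eq_tr φ hcomm, hval φ] at h2
    exact_mod_cast h2.symm
  rw [hNsψ, hNφ, norm_zero] at h1
  have h3 : N ψ = 0 := by
    have : ‖N ψ‖ ^ 2 = 0 := by nlinarith [sq_nonneg ‖N ψ‖, sq_nonneg ‖star N φ‖]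
    simpa using this
  rw [h3] at hNψ
  exact (sub_eq_zero.1 hNψ.symm).symm

/-- As the projection of `ψ` acts as `c`, its trace pairing with the projection of any unit `x` is
`c`, which is also the square norm of both. The two projections then coincide, so expectations of
`T` do not depend on the unit vector. -/
theorem exists_eq_smul_one (hΦ : IsTraceProjection M Φ) {c : ℝ}
    (h : ∀ x, Φ (rankOne ℂ x x) x = ((c : ℂ) * inner ℂ x x) • x) {ψ : H} (hψ : ‖ψ‖ = 1)
    (hD : ∀ θ, Φ (rankOne ℂ ψ ψ) θ = (c : ℂ) • θ) {T : Op H} (hT : T ∈ M) :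
    ∃ τ : ℂ, T = τ • 1 := by
  have unit : ∀ {x : H}, ‖x‖ = 1 → inner ℂ x x = 1 := fun hx => by
    rw [inner_self_eq_norm_sq_to_K, hx]; simp
  have e2 : ∀ x : H, ‖x‖ = 1 → tr (Φ (rankOne ℂ x x) * Φ (rankOne ℂ x x)) = c := fun x hx => by
    rw [hΦ.tr_mul_self, h, unit hx, mul_one, inner_smul_right, unit hx, mul_one]
  refine ⟨tr (Φ (rankOne ℂ ψ ψ) * T), eq_smul_one_of_inner_apply_self fun x hx => ?_⟩
  rw [hΦ.inner_eq_tr x hT]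
  have : Φ (rankOne ℂ x x) = Φ (rankOne ℂ ψ ψ) := by
    refine sub_eq_zero.1 (isSelfAdjoint_eq_zero_of_tr_mul_self
      ((hΦ.isSelfAdjoint_rankOne x).sub (hΦ.isSelfAdjoint_rankOne ψ)) ?_)
    have e1 : tr (Φ (rankOne ℂ x x) * Φ (rankOne ℂ ψ ψ)) = c := by
      rw [← hΦ.inner_eq_tr x (hΦ.mem _), hD, inner_smul_right, unit hx, mul_one]
    rw [sub_mul, mul_sub, mul_sub, map_sub, map_sub, map_sub, e2 ψ hψ, e2 x hx, e1, tr_mul_comm,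
      e1]
    ring
  rw [this]

end IsTraceProjection

variable {L : LieSubalgebra ℝ (Op H)}

/-- If all pure states have the same purity relative to `L`, then `L` is scalar or moves every ray
in all directions. -/
theorem isRayTransitiveAt_or_scalar (hL : ∀ T ∈ L, star T = -T)
    (hΦ : IsTraceProjection (complexification L) Φ) {c : ℝ}
    (h : ∀ x, Φ (rankOne ℂ x x) x = ((c : ℂ) * inner ℂ x x) • x) {ψ : H} (hψ : ‖ψ‖ = 1) :
    IsRayTransitiveAt L ψ ∨ ∀ T ∈ L, ∃ τ : ℂ, T = τ • 1 := by
  have hM : ∀ X ∈ complexification L, ∀ Y ∈ complexification L,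
      X * Y - Y * X ∈ complexification L := fun X hX Y hY => commutator_mem_complexification hX hY
  have hψψ : inner ℂ ψ ψ = 1 := by rw [inner_self_eq_norm_sq_to_K, hψ]; simp
  -- A second eigenvector of `D` for the eigenvalue `c`, orthogonal to `ψ`, leads to the scalar
  -- case. Without one, `c - D` is injective on the orthogonal complement of `ψ`, hence surjective
  -- there.
  by_cases hc : ∃ φ, ‖φ‖ = 1 ∧ inner ℂ ψ φ = 0 ∧ Φ (rankOne ℂ ψ ψ) φ = (c : ℂ) • φ
  · obtain ⟨φ, hφ, hψφ, hD⟩ := hc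
    exact Or.inr fun T hT => hΦ.exists_eq_smul_one h hψ
      (hΦ.apply_eq_of_eigenvector hM h hψ hφ hψφ hD) (mem_complexification hT)
  left
  set D := Φ (rankOne ℂ ψ ψ) with hDdef
  have hDψ : D ψ = (c : ℂ) • ψ := by rw [hDdef, h, hψψ, mul_one]
  let K : Submodule ℂ H := LinearMap.ker (innerSL ℂ ψ : H →ₗ[ℂ] ℂ)
  have hK : ∀ x, x ∈ K ↔ inner ℂ ψ x = 0 := fun x => Iff.rfl
  let E : H →ₗ[ℂ] H := ((c : ℂ) • (1 : Op H) - D : Op H)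
  have hE : ∀ x, E x = (c : ℂ) • x - D x := fun x => rfl
  have hmaps : ∀ x ∈ K, E x ∈ K := fun x hx => by
    rw [hK] at hx ⊢
    rw [hE, inner_sub_right, inner_smul_right, hx,
      inner_apply_of_isSelfAdjoint (hΦ.isSelfAdjoint_rankOne ψ) ψ, ← hDdef, hDψ, inner_smul_left, hx]
    simp
  have hinj : Function.Injective (E.restrict hmaps) := by
    rw [← LinearMap.ker_eq_bot, LinearMap.ker_eq_bot']
    intro x hx
    by_contra hx0
    have hx1 : (x : H) ≠ 0 := fun h0 => hx0 (Subtype.ext h0)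
    have hx2 : D x = (c : ℂ) • (x : H) := (sub_eq_zero.1 (congrArg Subtype.val hx)).symm
    refine hc ⟨((‖(x : H)‖⁻¹ : ℝ) : ℂ) • (x : H), ?_, ?_, ?_⟩
    · rw [norm_smul, Complex.norm_real, norm_inv, norm_norm, inv_mul_cancel₀ (by simpa using hx1)]
    · rw [inner_smul_right, (hK _).1 x.2, mul_zero]
    · rw [map_smul, hx2, smul_comm]
  have hsurj := LinearMap.injective_iff_surjective.1 hinj
  intro v hv
  -- The factor `-i` cancels the `i` in the element `i(N + N*)` of `L`. Since `N*ψ = 0`, that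
  -- element sends `ψ` exactly to `v`.
  obtain ⟨⟨θ, hθ⟩, hθv⟩ := hsurj ⟨-Complex.I • v, by rw [hK, inner_smul_right, hv, mul_zero]⟩
  have hθv' : (c : ℂ) • θ - D θ = -Complex.I • v := congrArg Subtype.val hθv
  rw [hK] at hθ
  have hθψ : inner ℂ θ ψ = 0 := by rw [← inner_conj_symm, hθ, map_zero]
  set N := Φ (rankOne ℂ θ ψ) with hN
  have hNψ : N ψ = (c : ℂ) • θ - D θ := by
    rw [eq_sub_iff_add_eq, add_comm]
    have h1 := (projection_polarization h ψ ψ θ).2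
    rwa [hψψ, hθ, mul_zero, zero_smul, zero_add, mul_one] at h1
  have hsN : star N = Φ (rankOne ℂ ψ θ) := by rw [hN, ← hΦ.map_star, star_rankOne]
  have hNsψ : star N ψ = 0 := by
    rw [hsN, (projection_polarization h ψ θ 0).1, hθψ, mul_zero, zero_smul]
  refine ⟨Complex.I • (N + star N), mem_of_mem_complexification hL
    (Submodule.smul_mem _ _ (add_mem (hΦ.mem _) (hΦ.star_mem _ (hΦ.mem _)))) ?_, 0, ?_⟩
  · rw [star_smul, star_add, star_star, add_comm, Complex.star_def, Complex.conj_I, neg_smul]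
  · change Complex.I • (N ψ + star N ψ) = _
    rw [hNψ, hNsψ, hθv', add_zero, smul_smul]
    simp

/-- The purity of a vector relative to `L`. -/
noncomputable def purity (Φ : Op H →ₗ[ℂ] Op H) (x : H) : ℝ :=
  (tr (Φ (rankOne ℂ x x) * rankOne ℂ x x)).re

theorem isBoundedBilinearMap_rankOne :
    IsBoundedBilinearMap ℝ fun q : H × H => (rankOne ℂ q.1 q.2 : Op H) where
  add_left x y z := by simp
  smul_left c x y := by simp [← Complex.coe_smul]
  add_right x y z := by simp
  smul_right c x y := by simp [← Complex.coe_smul]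
  bound := ⟨1, one_pos, fun x y => by simp⟩

/-- The real part of the trace as a real continuous linear functional. -/
noncomputable def reTr : Op H →L[ℝ] ℝ :=
  LinearMap.toContinuousLinearMap (Complex.reLm ∘ₗ (tr : Op H →ₗ[ℂ] ℂ).restrictScalars ℝ)

theorem contDiff_purity (Φ : Op H →ₗ[ℂ] Op H) : ContDiff ℝ 1 (purity Φ) := by
  have h : ContDiff ℝ 1 fun x : H => (rankOne ℂ x x : Op H) := by
    have h0 := (isBoundedBilinearMap_rankOne (H := H)).contDiff (n := 1) |>.comp
      (contDiff_id.prodMk contDiff_id)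
    exact h0
  exact reTr.contDiff.comp
    (((LinearMap.toContinuousLinearMap (Φ.restrictScalars ℝ)).contDiff.comp h).mul h)

/-- The purity is quartic. Symmetry of `Φ` for the trace form and self-adjointness of the projected
state make its four slots contribute equally, whence the factor `4`. -/
theorem hasDerivAt_purity_comp (hΦ : IsTraceProjection M Φ) {γ : ℝ → H} {γ' : H} {t : ℝ}
    (h : HasDerivAt γ γ' t) :
    HasDerivAt (fun s => purity Φ (γ s))
      (4 * (inner ℂ (Φ (rankOne ℂ (γ t) (γ t)) (γ t)) γ').re) t := by
  have h1 : HasDerivAt (fun s => (rankOne ℂ (γ s) (γ s) : Op H))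
      (rankOne ℂ (γ t) γ' + rankOne ℂ γ' (γ t)) t := by
    have h0 := ((isBoundedBilinearMap_rankOne (H := H)).hasFDerivAt (γ t, γ t)).comp_hasDerivAt t
      (h.prodMk h)
    exact h0
  have h2 := reTr.hasFDerivAt.comp_hasDerivAt t
    (((LinearMap.toContinuousLinearMap (Φ.restrictScalars ℝ)).hasFDerivAt.comp_hasDerivAt t h1).mul
      h1)
  refine h2.congr_deriv ?_
  set B := Φ (rankOne ℂ (γ t) (γ t)) with hB
  set R : Op H := rankOne ℂ (γ t) γ' + rankOne ℂ γ' (γ t) with hR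
  change (tr (Φ R * rankOne ℂ (γ t) (γ t) + B * R)).re = _
  have e1 : tr (Φ R * rankOne ℂ (γ t) (γ t)) = tr (B * R) := by
    rw [hΦ.tr_mul_symm, tr_mul_comm]
  have e2 : tr (B * R) = inner ℂ γ' (B (γ t)) + inner ℂ (B (γ t)) γ' := by
    rw [hR, mul_add, map_add, tr_mul_rankOne, tr_mul_rankOne,
      inner_apply_of_isSelfAdjoint (hΦ.isSelfAdjoint_rankOne (γ t)) (γ t)]
  have e3 : (inner ℂ γ' (B (γ t))).re = (inner ℂ (B (γ t)) γ').re := by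
    rw [← inner_conj_symm, Complex.conj_re]
  rw [map_add, e1, e2, Complex.add_re, Complex.add_re, e3]
  ring

/-- A constant purity on the unit sphere has a pointwise consequence. -/
theorem projection_apply_of_purity_const (hΦ : IsTraceProjection M Φ) {c : ℝ}
    (h : ∀ x, ‖x‖ = 1 → purity Φ x = c) (x : H) :
    Φ (rankOne ℂ x x) x = ((c : ℂ) * inner ℂ x x) • x := by
  -- Homogeneity of degree four extends the constant on the sphere to `c‖x‖⁴` on all of `H`; the
  -- claim compares the derivatives of the two sides in every direction `v`.
  have hom : ∀ x, purity Φ x = c * ((inner ℂ x x).re * (inner ℂ x x).re) := by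
    intro x
    rcases eq_or_ne x 0 with rfl | hx
    · simp [purity]
    have hn : ‖x‖ ≠ 0 := by simpa using hx
    have h1 := h (((‖x‖⁻¹ : ℝ) : ℂ) • x) (by
      rw [norm_smul, Complex.norm_real, norm_inv, norm_norm, inv_mul_cancel₀ hn])
    have h2 : ((‖x‖⁻¹ : ℝ) : ℂ) * ((‖x‖⁻¹ : ℝ) : ℂ) * (((‖x‖⁻¹ : ℝ) : ℂ) * ((‖x‖⁻¹ : ℝ) : ℂ)) =
        ((‖x‖⁻¹ * ‖x‖⁻¹ * (‖x‖⁻¹ * ‖x‖⁻¹) : ℝ) : ℂ) := by push_cast; rfl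
    simp only [purity, map_smul, map_smulₛₗ, _root_.smul_apply, smul_smul, Complex.conj_ofReal,
      smul_mul_smul_comm, smul_eq_mul, h2, Complex.re_ofReal_mul] at h1
    have h3 : (inner ℂ x x).re = ‖x‖ * ‖x‖ := by
      rw [inner_self_eq_norm_sq_to_K, ← sq]
      norm_cast
    rw [h3, ← h1, purity]
    field_simp
  have hre : ∀ v, (inner ℂ (Φ (rankOne ℂ x x) x - ((c : ℂ) * inner ℂ x x) • x) v).re = 0 := by
    intro v
    have hγ : HasDerivAt (fun s : ℝ => x + s • v) v 0 := by
      simpa using ((hasDerivAt_id (0 : ℝ)).smul_const v).const_add x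
    have h1 := hasDerivAt_purity_comp hΦ hγ
    have h2 : HasDerivAt (fun s : ℝ => (inner ℂ (x + s • v) (x + s • v)).re)
        (2 * (inner ℂ x v).re) 0 := by
      have h3 := Complex.reCLM.hasFDerivAt.comp_hasDerivAt (0 : ℝ) (hγ.inner ℂ hγ)
      refine h3.congr_deriv ?_
      have h6 : x + (0 : ℝ) • v = x := by rw [zero_smul, add_zero]
      have h7 : (inner ℂ v x).re = (inner ℂ x v).re := by
        rw [← inner_conj_symm, Complex.conj_re]
      rw [h6, Complex.reCLM_apply, Complex.add_re, h7]
      ring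
    have h3 := (h2.mul h2).const_mul c
    simp only [hom, zero_smul, add_zero] at h1
    have h4 := h1.unique h3
    have h5 : inner ℂ x x = ((inner ℂ x x).re : ℂ) := by
      rw [inner_self_eq_norm_sq_to_K]
      norm_cast
    rw [inner_sub_left, inner_smul_left, map_mul, inner_conj_symm, Complex.conj_ofReal, h5,
      mul_assoc, Complex.sub_re, Complex.re_ofReal_mul, Complex.re_ofReal_mul]
    have h6 : x + (0 : ℝ) • v = x := by rw [zero_smul, add_zero]
    rw [h6] at h4
    linarith
  exact sub_eq_zero.1 ((inner_self_eq_zero (𝕜 := ℂ)).1 (Complex.ext (hre _) (inner_self_im (𝕜 := ℂ) _)))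

end Purity

/-! ### Functions that are constant along solutions -/

section Invariants

open MeasureTheory Set Filter Topology

/-- For an integrable `f` the curve is differentiable only almost everywhere, so a zero derivative
alone would not suffice. But `F` is Lipschitz on a ball containing the curve, so `F` along the curve
is absolutely continuous, and an absolutely continuous function with derivative zero almost
everywhere is constant. -/
theorem intervalIntegral_comp_const_of_fderiv_eq_zero {E : Type*} [NormedAddCommGroup E]
    [NormedSpace ℝ E] [FiniteDimensional ℝ E] {F : E → ℝ} (hF : ContDiff ℝ 1 F) {f : ℝ → E}
    {a : E} {T : ℝ} (hf : IntervalIntegrable f volume 0 T)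
    (h : ∀ t ∈ uIcc 0 T, fderiv ℝ F (a + ∫ s in (0 : ℝ)..t, f s) (f t) = 0) :
    F (a + ∫ s in (0 : ℝ)..T, f s) = F a := by
  have : CompleteSpace E := FiniteDimensional.complete ℝ E
  set γ : ℝ → E := fun t => a + ∫ s in (0 : ℝ)..t, f s with hγ
  have hcont : ContinuousOn γ (uIcc 0 T) :=
    continuousOn_const.add
      (intervalIntegral.continuousOn_primitive_interval' hf left_mem_uIcc)
  obtain ⟨R, hR⟩ := ((isCompact_uIcc.image_of_continuousOn hcont).isBounded).subset_closedBall 0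
  obtain ⟨C, hC⟩ := (isCompact_closedBall (0 : E) R).exists_bound_of_continuousOn
    ((hF.continuous_fderiv one_ne_zero).continuousOn (s := Metric.closedBall (0 : E) R))
  have hlip : ∀ x ∈ Metric.closedBall (0 : E) R, ∀ y ∈ Metric.closedBall (0 : E) R,
      ‖F y - F x‖ ≤ C * ‖y - x‖ := fun x hx y hy =>
    (convex_closedBall (0 : E) R).norm_image_sub_le_of_norm_fderiv_le
      (fun z _ => hF.differentiable one_ne_zero z) hC hx hy
  -- The increments are dominated by those of `C` times the primitive of `‖f‖`.
  have hac : AbsolutelyContinuousOnInterval (F ∘ γ) 0 T := by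
    have h1 := (hf.norm.absolutelyContinuousOnInterval_intervalIntegral
      (left_mem_uIcc (a := 0) (b := T))).const_mul C
    refine squeeze_zero' (Eventually.of_forall fun _ => Finset.sum_nonneg fun _ _ => dist_nonneg)
      ?_ h1
    have h2 : ∀ᶠ E in AbsolutelyContinuousOnInterval.totalLengthFilter ⊓
        𝓟 (AbsolutelyContinuousOnInterval.disjWithin 0 T),
        E ∈ AbsolutelyContinuousOnInterval.disjWithin 0 T :=
      mem_inf_of_right (mem_principal_self _)
    filter_upwards [h2] with E hE
    refine Finset.sum_le_sum fun i hi => ?_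
    obtain ⟨hx, hy⟩ := hE.1 i hi
    set x := (E.2 i).1
    set y := (E.2 i).2
    have hfx : IntervalIntegrable f volume 0 x := hf.mono_set (uIcc_subset_uIcc left_mem_uIcc hx)
    have hfy : IntervalIntegrable f volume 0 y := hf.mono_set (uIcc_subset_uIcc left_mem_uIcc hy)
    have h3 := hlip _ (hR (mem_image_of_mem _ hy)) _ (hR (mem_image_of_mem _ hx))
    have hC0 : 0 ≤ C := (norm_nonneg _).trans (hC _ (hR (mem_image_of_mem _ hy)))
    rw [dist_eq_norm, Function.comp_apply, Function.comp_apply]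
    refine h3.trans ?_
    have h4 : γ x - γ y = ∫ s in y..x, f s := by
      rw [hγ, add_sub_add_left_eq_sub, intervalIntegral.integral_interval_sub_left hfx hfy]
    rw [h4, Real.dist_eq, ← mul_sub, intervalIntegral.integral_interval_sub_left hfx.norm hfy.norm,
      abs_mul, abs_of_nonneg hC0]
    exact mul_le_mul_of_nonneg_left intervalIntegral.norm_integral_le_abs_integral_norm hC0
  have hae : ∀ᵐ x, x ∈ uIcc 0 T → HasDerivAt (F ∘ γ) 0 x := by
    filter_upwards [hf.ae_hasDerivAt_integral] with x hx hxT
    have h1 := (hx hxT 0 left_mem_uIcc).const_add a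
    have h2 := ((hF.differentiable one_ne_zero (γ x)).hasFDerivAt).comp_hasDerivAt x h1
    rwa [h x hxT] at h2
  obtain ⟨c, hc⟩ := hac.const_of_ae_hasDerivAt_zero hae
  have h0 := hc 0 left_mem_uIcc
  have hT := hc T right_mem_uIcc
  simp only [Function.comp_apply, hγ] at h0 hT
  rw [hT, ← h0]
  simp

/-! ### Invariants of the controlled Schrödinger equation -/

variable {H : Type*} [NormedAddCommGroup H] [InnerProductSpace ℂ H] [FiniteDimensional ℂ H]
  {m : ℕ} {H₀ : Op H} {Hc : Fin m → Op H}

theorem generator_mem_dynamicalAlgebra (c : Fin m → ℝ) :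
    (-Complex.I) • (H₀ + ∑ j, c j • Hc j) ∈ dynamicalAlgebra H₀ Hc := by
  rw [smul_add, Finset.smul_sum]
  refine add_mem (LieSubalgebra.subset_lieSpan (mem_insert _ _)) (sum_mem fun j _ => ?_)
  rw [smul_comm]
  exact (dynamicalAlgebra H₀ Hc).smul_mem _
    (LieSubalgebra.subset_lieSpan (mem_insert_of_mem _ (mem_range_self j)))

/-- The Lie algebra of skew-adjoint operators. -/
def skewAlgebra (H : Type*) [NormedAddCommGroup H] [InnerProductSpace ℂ H]
    [FiniteDimensional ℂ H] : LieSubalgebra ℝ (Op H) where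
  carrier := {T | star T = -T}
  zero_mem' := by simp
  add_mem' {S T} hS hT := by
    rw [mem_ofPred_eq] at *
    rw [star_add, hS, hT, neg_add]
  smul_mem' c {T} hT := by
    rw [mem_ofPred_eq] at *
    rw [star_smul, hT, star_trivial, smul_neg]
  lie_mem' {S T} hS hT := by
    change star S = -S at hS
    change star T = -T at hT
    change star (S * T - T * S) = -(S * T - T * S)
    rw [star_sub, star_mul, star_mul, hS, hT]
    noncomm_ring

theorem mem_skewAlgebra {T : Op H} : T ∈ skewAlgebra H ↔ star T = -T := Iff.rfl

theorem neg_I_smul_mem_skewAlgebra {A : Op H} (hA : IsSelfAdjoint A) :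
    (-Complex.I) • A ∈ skewAlgebra H := by
  rw [mem_skewAlgebra, star_smul, hA.star_eq, star_neg, Complex.star_def, Complex.conj_I, neg_smul]

theorem dynamicalAlgebra_le_skewAlgebra (hH₀ : IsSelfAdjoint H₀)
    (hHc : ∀ j, IsSelfAdjoint (Hc j)) : dynamicalAlgebra H₀ Hc ≤ skewAlgebra H := by
  refine LieSubalgebra.lieSpan_le.2 (insert_subset (neg_I_smul_mem_skewAlgebra hH₀) ?_)
  rintro _ ⟨j, rfl⟩
  exact neg_I_smul_mem_skewAlgebra (hHc j)

theorem intervalIntegrable_schrodinger {u : ℝ → Fin m → ℝ}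
    (hu : LocallyIntegrableOn u (Ici 0)) {T : ℝ} (hT : 0 ≤ T) {ψ : ℝ → H}
    (hψ : ContinuousOn ψ (Icc 0 T)) :
    IntervalIntegrable (fun s => (-Complex.I) • (H₀ + ∑ j, u s j • Hc j) (ψ s)) volume 0 T := by
  rw [← uIcc_of_le hT] at hψ
  have h1 : IntegrableOn u (Icc 0 T) :=
    hu.integrableOn_compact_subset Icc_subset_Ici_self isCompact_Icc
  have h2 : ∀ j, IntervalIntegrable (fun s => u s j) volume 0 T := fun j => by
    rw [intervalIntegrable_iff_integrableOn_Icc_of_le hT]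
    exact Integrable.eval (f := u) h1 j
  have hc : ∀ A : Op H, ContinuousOn (fun s => (-Complex.I) • A (ψ s)) (uIcc 0 T) := fun A =>
    (A.continuous.comp_continuousOn hψ).const_smul _
  have h3 : IntervalIntegrable (fun s => (-Complex.I) • H₀ (ψ s) +
      ∑ j, u s j • ((-Complex.I) • Hc j (ψ s))) volume 0 T := by
    refine (hc H₀).intervalIntegrable.add ?_
    have h4 := IntervalIntegrable.sum Finset.univ fun j _ => (h2 j).smul_continuousOn (hc (Hc j))
    have e : (∑ j, fun s => u s j • ((-Complex.I) • Hc j (ψ s))) =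
        fun s => ∑ j, u s j • ((-Complex.I) • Hc j (ψ s)) := by
      ext s
      simp
    rw [← e]
    exact h4
  convert h3 using 1
  ext s
  simp only [_root_.add_apply, _root_.sum_apply, _root_.smul_apply, smul_add,
    Finset.smul_sum]
  congr 1
  exact Finset.sum_congr rfl fun j _ => smul_comm _ _ _

/-- A `C¹` function whose derivative vanishes along the dynamical algebra is constant along
solutions. -/
theorem IsSchrodingerSolution.apply_eq {F : H → ℝ} (hF : ContDiff ℝ 1 F)
    (h : ∀ X ∈ dynamicalAlgebra H₀ Hc, ∀ x, fderiv ℝ F x (X x) = 0) {u : ℝ → Fin m → ℝ}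
    (hu : LocallyIntegrableOn u (Ici 0)) {T : ℝ} (hT : 0 ≤ T) {ψ : ℝ → H}
    (hψ : IsSchrodingerSolution H₀ Hc u T ψ) : F (ψ T) = F (ψ 0) := by
  rw [hψ.2 T (right_mem_Icc.2 hT)]
  refine intervalIntegral_comp_const_of_fderiv_eq_zero hF
    (intervalIntegrable_schrodinger hu hT hψ.1) fun t ht => ?_
  rw [uIcc_of_le hT] at ht
  rw [← hψ.2 t ht]
  exact h _ (generator_mem_dynamicalAlgebra (u t)) (ψ t)

theorem fderiv_purity_apply {M : Submodule ℂ (Op H)} {Φ : Op H →ₗ[ℂ] Op H}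
    (hΦ : IsTraceProjection M Φ) (x v : H) :
    fderiv ℝ (purity Φ) x v = 4 * (inner ℂ (Φ (rankOne ℂ x x) x) v).re := by
  have hγ : HasDerivAt (fun s : ℝ => x + s • v) v 0 := by
    simpa using ((hasDerivAt_id (0 : ℝ)).smul_const v).const_add x
  have h0 : x + (0 : ℝ) • v = x := by rw [zero_smul, add_zero]
  have h1 := hasDerivAt_purity_comp hΦ hγ
  have h2 := ((contDiff_purity Φ).differentiable one_ne_zero
    (x + (0 : ℝ) • v)).hasFDerivAt.comp_hasDerivAt (0 : ℝ) hγ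
  have h3 := h2.unique h1
  rwa [h0] at h3

theorem exists_unit_orthogonal (hn : 2 ≤ Module.finrank ℂ H) (ψ : H) :
    ∃ φ : H, ‖φ‖ = 1 ∧ inner ℂ ψ φ = 0 := by
  have h1 : (innerSL ℂ ψ : H →ₗ[ℂ] ℂ).ker ≠ ⊥ := by
    intro h
    have h2 := LinearMap.finrank_range_add_finrank_ker (innerSL ℂ ψ : H →ₗ[ℂ] ℂ)
    have h3 := Submodule.finrank_le (innerSL ℂ ψ : H →ₗ[ℂ] ℂ).range
    rw [h, finrank_bot] at h2
    rw [Module.finrank_self] at h3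
    omega
  obtain ⟨v, hv, hv0⟩ := Submodule.exists_mem_ne_zero_of_ne_bot h1
  have hv' : inner ℂ ψ v = 0 := hv
  refine ⟨((‖v‖⁻¹ : ℝ) : ℂ) • v, ?_, ?_⟩
  · rw [norm_smul, Complex.norm_real, norm_inv, norm_norm, inv_mul_cancel₀ (by simpa using hv0)]
  · rw [inner_smul_right, hv', mul_zero]

/-- Controllability implies that the dynamical algebra moves every ray in all directions. -/
theorem PureStateControllable.isRayTransitiveAt (hn : 2 ≤ Module.finrank ℂ H)
    (hH₀ : IsSelfAdjoint H₀) (hHc : ∀ j, IsSelfAdjoint (Hc j)) {𝒰 : Set (ℝ → Fin m → ℝ)}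
    (h𝒰 : ∀ u ∈ 𝒰, LocallyIntegrableOn u (Ici 0)) (h : PureStateControllable 𝒰 H₀ Hc) {ψ : H}
    (hψ : ‖ψ‖ = 1) : IsRayTransitiveAt (dynamicalAlgebra H₀ Hc) ψ := by
  have hL : ∀ T ∈ dynamicalAlgebra H₀ Hc, star T = -T := fun T hT =>
    dynamicalAlgebra_le_skewAlgebra hH₀ hHc hT
  -- Controllability joins any two unit vectors by a solution, so an invariant of the dynamical
  -- algebra is constant on the sphere.
  have inv : ∀ {F : H → ℝ}, ContDiff ℝ 1 F →
      (∀ X ∈ dynamicalAlgebra H₀ Hc, ∀ x, fderiv ℝ F x (X x) = 0) → ∀ {x y : H}, ‖x‖ = 1 →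
      ‖y‖ = 1 → F y = F x := by
    intro F hF hFX x y hx hy
    obtain ⟨u, hu, T, hT, χ, hχ, rfl, rfl⟩ := h x y hx hy
    exact hχ.apply_eq hF hFX (h𝒰 u hu) hT.le
  obtain ⟨Φ, hΦ⟩ := exists_isTraceProjection _ (star_mem_complexification hL)
  have hconst : ∀ x, ‖x‖ = 1 → purity Φ x = purity Φ ψ := fun x hx =>
    inv (contDiff_purity Φ) (fun X hX x => by
      rw [fderiv_purity_apply hΦ, re_inner_projection_apply hL hΦ hX, mul_zero]) hψ hx
  refine (isRayTransitiveAt_or_scalar hL hΦ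
    (projection_apply_of_purity_const hΦ hconst) hψ).resolve_right
    fun hscal => ?_
  obtain ⟨φ, hφ, hψφ⟩ := exists_unit_orthogonal hn ψ
  -- In the scalar case the scalars are imaginary, so `|⟨ψ, x⟩|²` is invariant. It equals `1` at `ψ`
  -- and `0` at `φ`.
  let ℓ : H →L[ℝ] ℂ := (innerSL ℂ ψ).restrictScalars ℝ
  have hℓ : ∀ x, HasFDerivAt (fun x => ‖ℓ x‖ ^ 2) _ x := fun x => ℓ.hasFDerivAt.norm_sq
  have h2 := inv (F := fun x => ‖ℓ x‖ ^ 2) (ℓ.contDiff.norm_sq ℝ) (fun X hX x => by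
    rw [(hℓ x).fderiv]
    obtain ⟨τ, rfl⟩ := hscal X hX
    have hτ : τ.re = 0 := by
      have h3 := DFunLike.congr_fun (hL _ hX) ψ
      have h4 : starRingEnd ℂ τ • ψ = -(τ • ψ) := by simpa using h3
      have h5 : (starRingEnd ℂ τ + τ) • ψ = 0 := by rw [add_smul, h4, neg_add_cancel]
      have h6 := (smul_eq_zero.1 h5).resolve_right (norm_ne_zero_iff.1 (by rw [hψ]; simp))
      have h7 := congrArg Complex.re h6
      simp at h7
      linarith
    have h3 : ℓ (τ • x) = τ * ℓ x := (innerSL ℂ ψ).map_smul τ x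
    simp [h3, hτ]
    ring) hψ hφ
  have h3 : ℓ φ = 0 := hψφ
  have h4 : ℓ ψ = 1 := by
    change inner ℂ ψ ψ = 1
    rw [inner_self_eq_norm_sq_to_K, hψ]
    simp
  simp [h3, h4] at h2

end Invariants

/-! ### Attainable directions -/

section Attainable

open MeasureTheory Set Filter Topology

variable {H : Type*} [NormedAddCommGroup H] [InnerProductSpace ℂ H] [FiniteDimensional ℂ H]

/-- `g` is the value of a strictly differentiable family in `S` whose velocities at `g` contain
`V * g`. -/
def IsAttained (S : Submonoid (Op H)) (g : Op H) (V : Submodule ℝ (Op H)) : Prop :=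
  ∃ (E : Type) (_ : NormedAddCommGroup E) (_ : NormedSpace ℝ E) (_ : CompleteSpace E)
    (P : E → Op H) (P' : E →L[ℝ] Op H) (x : E), HasStrictFDerivAt P P' x ∧ P x = g ∧
    (∀ᶠ y in 𝓝 x, P y ∈ S) ∧ ∀ Z ∈ V, ∃ e, P' e = Z * g

/-- Conjugation by `g`. -/
noncomputable def conjBy (g : Op H) : Op H →ₗ[ℝ] Op H where
  toFun Z := g * Z * star g
  map_add' := by intros; simp [mul_add, add_mul]
  map_smul' := by intros; simp

theorem conjBy_apply (g Z : Op H) : conjBy g Z = g * Z * star g := rfl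

theorem conjBy_conjBy (g h Z : Op H) : conjBy g (conjBy h Z) = conjBy (g * h) Z := by
  simp only [conjBy_apply, star_mul, mul_assoc]

variable {S : Submonoid (Op H)}

theorem isAttained_bot {g : Op H} (hg : g ∈ S) : IsAttained S g ⊥ :=
  ⟨ℝ, inferInstance, inferInstance, inferInstance, fun _ => g, 0, 0, hasStrictFDerivAt_const _ _,
    rfl, Eventually.of_forall fun _ => hg, fun Z hZ => ⟨0, by
      rw [Submodule.mem_bot] at hZ
      simp [hZ]⟩⟩

/-- At a strictly positive time, both slightly shorter and slightly longer times are allowed, so a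
whole line of velocities is available although only forward evolution is. -/
theorem isAttained_exp {X : Op H} (hX : ∀ t : ℝ, 0 < t → NormedSpace.exp (t • X) ∈ S) {t : ℝ}
    (ht : 0 < t) : IsAttained S (NormedSpace.exp (t • X)) (Submodule.span ℝ {X}) := by
  refine ⟨ℝ, inferInstance, inferInstance, inferInstance, fun s => NormedSpace.exp (s • X), _, t,
    (hasStrictDerivAt_exp_smul_const' (𝕂 := ℝ) X t).hasStrictFDerivAt, rfl, ?_, fun Z hZ => ?_⟩
  · filter_upwards [lt_mem_nhds ht] with s hs using hX s hs
  · obtain ⟨r, rfl⟩ := Submodule.mem_span_singleton.1 hZ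
    exact ⟨r, by simp⟩

/-- In the product rule the velocity `Wh` of the second factor appears as `gWh = (gWg*)gh`, hence
the conjugation. -/
theorem IsAttained.mul {g h : Op H} {V W : Submodule ℝ (Op H)} (hg : IsAttained S g V)
    (hh : IsAttained S h W) (hgg : star g * g = 1) :
    IsAttained S (g * h) (V ⊔ W.map (conjBy g)) := by
  obtain ⟨E, _, _, _, P, P', x, hP, rfl, hPS, hPV⟩ := hg
  obtain ⟨F, _, _, _, Q, Q', y, hQ, rfl, hQS, hQW⟩ := hh
  refine ⟨E × F, inferInstance, inferInstance, inferInstance, fun z => P z.1 * Q z.2, _, (x, y),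
    HasStrictFDerivAt.mul' (hP.comp (x, y) hasStrictFDerivAt_fst)
      (hQ.comp (x, y) hasStrictFDerivAt_snd), rfl, ?_, fun Z hZ => ?_⟩
  · rw [nhds_prod_eq]
    filter_upwards [hPS.prod_mk hQS] with z hz using mul_mem hz.1 hz.2
  · obtain ⟨v, hv, w', hw', rfl⟩ := Submodule.mem_sup.1 hZ
    obtain ⟨w, hw, rfl⟩ := Submodule.mem_map.1 hw'
    obtain ⟨e, he⟩ := hPV v hv
    obtain ⟨f, hf⟩ := hQW w hw
    refine ⟨(e, f), ?_⟩
    change P x * Q' f + P' e * Q y = _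
    rw [he, hf, conjBy_apply, add_mul, mul_assoc (P x * w), ← mul_assoc (star (P x)), hgg]
    noncomm_ring

theorem IsAttained.mono {g : Op H} {V W : Submodule ℝ (Op H)} (hg : IsAttained S g V)
    (hW : W ≤ V) : IsAttained S g W := by
  obtain ⟨E, i1, i2, i3, P, P', x, hP, hg, hPS, hPV⟩ := hg
  exact ⟨E, i1, i2, i3, P, P', x, hP, hg, hPS, fun Z hZ => hPV Z (hW hZ)⟩

/-- The span of all `h X h*` with `h ∈ S` and `X ∈ Γ`. -/
noncomputable def attainableSpan (S : Submonoid (Op H)) (Γ : Set (Op H)) : Submodule ℝ (Op H) :=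
  Submodule.span ℝ {Z | ∃ h ∈ S, ∃ X ∈ Γ, Z = conjBy h X}

variable {Γ : Set (Op H)}

theorem attainableSpan_le_iff {W : Submodule ℝ (Op H)} :
    attainableSpan S Γ ≤ W ↔ ∀ h ∈ S, ∀ X ∈ Γ, conjBy h X ∈ W := by
  rw [attainableSpan, Submodule.span_le]
  exact ⟨fun H h hh X hX => H ⟨h, hh, X, hX, rfl⟩, fun H Z ⟨h, hh, X, hX, hZ⟩ => by
    rw [hZ, SetLike.mem_coe]
    exact H h hh X hX⟩

theorem conjBy_mem_attainableSpan_of_mem {h X : Op H} (hh : h ∈ S) (hX : X ∈ Γ) :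
    conjBy h X ∈ attainableSpan S Γ :=
  attainableSpan_le_iff.1 le_rfl h hh X hX

theorem conjBy_mem_attainableSpan {g : Op H} (hg : g ∈ S) {Z : Op H}
    (hZ : Z ∈ attainableSpan S Γ) : conjBy g Z ∈ attainableSpan S Γ := by
  have h : attainableSpan S Γ ≤ (attainableSpan S Γ).comap (conjBy g) := by
    rw [attainableSpan_le_iff]
    intro h hh X hX
    rw [Submodule.mem_comap, conjBy_conjBy]
    exact conjBy_mem_attainableSpan_of_mem (mul_mem hg hh) hX
  exact Submodule.mem_comap.1 (h hZ)

theorem subset_attainableSpan : Γ ⊆ attainableSpan S Γ := fun X hX =>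
  Submodule.subset_span ⟨1, one_mem _, X, hX, by simp [conjBy_apply]⟩

/-- A single element of `S` attains all the attainable directions. -/
theorem exists_isAttained (hS : ∀ g ∈ S, star g * g = 1)
    (hΓ : ∀ X ∈ Γ, ∀ t : ℝ, 0 < t → NormedSpace.exp (t • X) ∈ S) :
    ∃ g ∈ S, IsAttained S g ((attainableSpan S Γ).map (conjBy g)) := by
  -- Take `V` maximal among the attained subspaces. Multiplying `g` by `h exp(X)` adds the direction
  -- `g(hXh*)g*`; by maximality it already lies in `V`.
  obtain ⟨V, ⟨g, hg, hV⟩, hmax⟩ := set_has_maximal_iff_noetherian.2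
    (inferInstance : IsNoetherian ℝ (Op H)) {V | ∃ g ∈ S, IsAttained S g V}
    ⟨⊥, 1, one_mem _, isAttained_bot (one_mem _)⟩
  refine ⟨g, hg, hV.mono ?_⟩
  rw [Submodule.map_le_iff_le_comap, attainableSpan_le_iff]
  intro h hh X hX
  rw [Submodule.mem_comap]
  have h1 := hΓ X hX 1 one_pos
  have h2 := hV.mul ((isAttained_bot hh).mul (isAttained_exp (hΓ X hX) one_pos) (hS h hh)) (hS g hg)
  have h3 := hmax _ ⟨_, mul_mem hg (mul_mem hh h1), h2⟩
  have h4 : V = V ⊔ (⊥ ⊔ (Submodule.span ℝ {X}).map (conjBy h)).map (conjBy g) :=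
    eq_of_le_of_not_lt le_sup_left h3
  rw [h4]
  refine Submodule.mem_sup_right (Submodule.mem_map_of_mem (Submodule.mem_sup_right
    (Submodule.mem_map_of_mem (Submodule.mem_span_singleton_self X))))

/-- The commutator is the derivative at `0` of the conjugation by `exp(tX)`. Difference quotients
with `t > 0` suffice for the limit, and they stay in the span, which is closed in finite dimension.
-/
theorem commutator_mem_attainableSpan
    (hΓ : ∀ X ∈ Γ, ∀ t : ℝ, 0 < t → NormedSpace.exp (t • X) ∈ S) {X : Op H} (hX : X ∈ Γ)
    (hXs : star X = -X) {Z : Op H} (hZ : Z ∈ attainableSpan S Γ) :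
    X * Z - Z * X ∈ attainableSpan S Γ := by
  have h1 : HasDerivAt (fun t : ℝ => NormedSpace.exp (t • X)) X 0 := by
    simpa using hasDerivAt_exp_smul_const (𝕂 := ℝ) X (0 : ℝ)
  have h2 : HasDerivAt (fun t : ℝ => conjBy (NormedSpace.exp (t • X)) Z) (X * Z - Z * X) 0 := by
    have h3 := (h1.mul_const Z).mul h1.star
    refine h3.congr_deriv ?_
    simp [hXs, sub_eq_add_neg]
  have h4 := (hasDerivAt_iff_tendsto_slope_zero.1 h2).mono_left
    (nhdsWithin_mono (0 : ℝ) fun t (ht : t ∈ Ioi (0 : ℝ)) => ne_of_gt ht)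
  refine (Submodule.closed_of_finiteDimensional (attainableSpan S Γ)).mem_of_tendsto h4 ?_
  filter_upwards [self_mem_nhdsWithin] with t ht
  refine Submodule.smul_mem _ _ (sub_mem ?_ ?_)
  · rw [zero_add]
    exact conjBy_mem_attainableSpan (hΓ X hX t ht) hZ
  · simpa [conjBy_apply] using hZ

/-! ### Orbits on the sphere -/

/-- `W` moves `ψ` in all directions tangent to the sphere. -/
def IsSphereTransitiveAt (W : Submodule ℝ (Op H)) (ψ : H) : Prop :=
  ∀ v, (inner ℂ ψ v).re = 0 → ∃ Z ∈ W, Z ψ = v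

theorem norm_apply_of_star_mul_self {g : Op H} (hg : star g * g = 1) (x : H) : ‖g x‖ = ‖x‖ := by
  have h : inner ℂ (g x) (g x) = inner ℂ x x := by
    rw [← inner_star_apply]
    exact congrArg (fun A : Op H => inner ℂ x (A x)) hg
  rw [inner_self_eq_norm_sq_to_K, inner_self_eq_norm_sq_to_K] at h
  have h2 : ‖g x‖ ^ 2 = ‖x‖ ^ 2 := by exact_mod_cast h
  exact (sq_eq_sq₀ (norm_nonneg _) (norm_nonneg _)).1 h2

/-- The map `(y, s) ↦ s P(y)ψ` has surjective strict derivative at `(x, 1)`: the family gives the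
directions tangent to the sphere and `s` the radial one. So it covers a neighbourhood of `gψ`, and a
unit vector in the image with `s > 0` has `s = 1`. -/
theorem eventually_mem_orbit (hS : ∀ g ∈ S, star g * g = 1 ∧ g * star g = 1)
    {W : Submodule ℝ (Op H)} {g : Op H} (hg : g ∈ S) (hgW : IsAttained S g (W.map (conjBy g)))
    {ψ : H} (hψ : ‖ψ‖ = 1) (hW : IsSphereTransitiveAt W ψ) :
    ∀ᶠ φ in 𝓝 (g ψ), ‖φ‖ = 1 → ∃ h ∈ S, φ = h ψ := by
  obtain ⟨E, _, _, _, P, P', x, hP, hPx, hPS, hPV⟩ := hgW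
  have : CompleteSpace H := FiniteDimensional.complete ℂ H
  let ev : Op H →L[ℝ] H := (ContinuousLinearMap.apply ℂ H ψ).restrictScalars ℝ
  have h1 := (hasStrictFDerivAt_snd (𝕜 := ℝ) (p := (x, (1 : ℝ)))).smul
    (ev.hasStrictFDerivAt.comp (x, (1 : ℝ)) (hP.comp (x, (1 : ℝ)) hasStrictFDerivAt_fst))
  have h2 := h1.map_nhds_eq_of_surj (by
    rw [LinearMap.range_eq_top]
    intro y
    set s := (inner ℂ ψ (star g y)).re with hs
    have hv : (inner ℂ ψ (star g y - s • ψ)).re = 0 := by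
      rw [inner_sub_right, ← Complex.coe_smul, inner_smul_right, inner_self_eq_norm_sq_to_K, hψ,
        Complex.sub_re, ← hs]
      simp
    obtain ⟨Z, hZ, hZψ⟩ := hW _ hv
    obtain ⟨e, he⟩ := hPV _ (Submodule.mem_map_of_mem hZ)
    refine ⟨(e, s), ?_⟩
    change (1 : ℝ) • (P' e) ψ + s • (P x ψ) = y
    have h3 : conjBy g Z * g = g * Z := by
      rw [conjBy_apply, mul_assoc, (hS g hg).1, mul_one]
    rw [he, hPx, h3]
    change (1 : ℝ) • g (Z ψ) + s • g ψ = y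
    rw [hZψ, map_sub, ← Complex.coe_smul s ψ, map_smul, Complex.coe_smul, one_smul,
      sub_add_cancel]
    exact DFunLike.congr_fun (hS g hg).2 y)
  have h3 : (1 : ℝ) • ev (P x) = g ψ := by rw [one_smul, hPx]; rfl
  change map _ _ = 𝓝 ((1 : ℝ) • ev (P x)) at h2
  rw [h3] at h2
  rw [← h2, eventually_map, nhds_prod_eq]
  filter_upwards [hPS.prod_mk (lt_mem_nhds one_pos)] with z hz hz1
  refine ⟨P z.1, hz.1, ?_⟩
  change z.2 • P z.1 ψ = P z.1 ψ
  have h4 : ‖z.2 • P z.1 ψ‖ = 1 := hz1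
  rw [norm_smul, norm_apply_of_star_mul_self (hS _ hz.1).1, hψ, mul_one,
    Real.norm_of_nonneg (le_of_lt hz.2)] at h4
  rw [h4, one_smul]

/-- Poincaré recurrence for a unitary operator. -/
theorem exists_pow_succ_norm_sub_lt {g : Op H} (hg : star g * g = 1) (ψ : H) {ε : ℝ}
    (hε : 0 < ε) : ∃ k : ℕ, ‖(g ^ (k + 1)) ψ - ψ‖ < ε := by
  have : ProperSpace H := FiniteDimensional.proper ℂ H
  have hpow : ∀ k : ℕ, star (g ^ k) * g ^ k = 1 := fun k => by
    induction k with
    | zero => simp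
    | succ k ih =>
      rw [pow_succ, star_mul, mul_assoc, ← mul_assoc (star (g ^ k)), ih, one_mul, hg]
  obtain ⟨a, -, φ, hφ, ha⟩ := (isCompact_closedBall (0 : H) ‖ψ‖).tendsto_subseq
    (x := fun k => (g ^ k) ψ) fun k => by
      rw [mem_closedBall_zero_iff, norm_apply_of_star_mul_self (hpow k)]
  obtain ⟨N, hN⟩ := Metric.cauchySeq_iff.1 ha.cauchySeq ε hε
  have h1 := hN (N + 1) (Nat.le_succ N) N le_rfl
  have h2 : φ N < φ (N + 1) := hφ (Nat.lt_succ_self N)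
  -- The power `k + 1` is the gap between two consecutive indices of a convergent subsequence; the
  -- isometry `g ^ φ N` cancels from the distance.
  refine ⟨φ (N + 1) - φ N - 1, ?_⟩
  have h3 : φ (N + 1) = φ N + (φ (N + 1) - φ N - 1 + 1) := by omega
  rw [dist_eq_norm] at h1
  have h4 : (g ^ φ (N + 1)) ψ - (g ^ φ N) ψ =
      (g ^ φ N) ((g ^ (φ (N + 1) - φ N - 1 + 1)) ψ - ψ) := by
    rw [map_sub]
    congr 1
    conv_lhs => rw [h3, pow_add]
    rfl
  simp only [Function.comp_apply] at h1
  rwa [h4, norm_apply_of_star_mul_self (hpow _)] at h1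

/-- The orbit contains a ball of the sphere around `gψ`. Inverses need not lie in `S`, but a power
`g ^ k` carries this ball to one around `g ^ (k + 1) ψ`, which recurrence places within half a
radius of `ψ`. -/
theorem exists_ball_subset_orbit (hS : ∀ g ∈ S, star g * g = 1 ∧ g * star g = 1)
    {W : Submodule ℝ (Op H)} {g : Op H} (hg : g ∈ S) (hgW : IsAttained S g (W.map (conjBy g)))
    {ψ : H} (hψ : ‖ψ‖ = 1) (hW : IsSphereTransitiveAt W ψ) :
    ∃ ε > 0, ∀ φ, ‖φ‖ = 1 → ‖φ - ψ‖ < ε → ∃ h ∈ S, φ = h ψ := by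
  obtain ⟨ε, hε, hball⟩ := Metric.eventually_nhds_iff.1 (eventually_mem_orbit hS hg hgW hψ hW)
  obtain ⟨k, hk⟩ := exists_pow_succ_norm_sub_lt (hS g hg).1 ψ (half_pos hε)
  refine ⟨ε / 2, half_pos hε, fun φ hφ hφψ => ?_⟩
  have hgk := hS _ (pow_mem hg k)
  have hinv : ∀ x, (g ^ k) (star (g ^ k) x) = x := fun x => DFunLike.congr_fun hgk.2 x
  have hnorm : ∀ x, ‖star (g ^ k) x‖ = ‖x‖ := fun x => by
    rw [← norm_apply_of_star_mul_self hgk.1, hinv]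
  have h1 : ‖star (g ^ k) φ - g ψ‖ < ε := by
    rw [← norm_apply_of_star_mul_self hgk.1, map_sub, hinv]
    have h2 : (g ^ k) (g ψ) = (g ^ (k + 1)) ψ := by rw [pow_succ]; rfl
    rw [h2]
    calc ‖φ - (g ^ (k + 1)) ψ‖ = ‖(φ - ψ) - ((g ^ (k + 1)) ψ - ψ)‖ := by rw [sub_sub_sub_cancel_right]
      _ ≤ ‖φ - ψ‖ + ‖(g ^ (k + 1)) ψ - ψ‖ := norm_sub_le _ _
      _ < ε := by linarith
  obtain ⟨h, hh, hφh⟩ := hball (by rwa [dist_eq_norm]) ((hnorm φ).trans hφ)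
  refine ⟨g ^ k * h, mul_mem (pow_mem hg k) hh, ?_⟩
  change φ = (g ^ k) (h ψ)
  rw [← hφh, hinv]

/-- Since `ε` is uniform, the `ε/2`-balls around `R` and those around the unit vectors outside `R`
form two disjoint open sets covering the sphere, which is connected in dimension above one. -/
theorem sphere_subset_of_uniform_ball {E : Type*} [NormedAddCommGroup E] [NormedSpace ℝ E]
    (hE : 1 < Module.rank ℝ E) {R : Set E} {x : E} (hx : ‖x‖ = 1) (hxR : x ∈ R) {ε : ℝ}
    (hε : 0 < ε) (hR : ∀ r ∈ R, ∀ y, ‖y‖ = 1 → ‖y - r‖ < ε → y ∈ R) {y : E} (hy : ‖y‖ = 1) :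
    y ∈ R := by
  have hsph : ∀ z : E, z ∈ Metric.sphere (0 : E) 1 ↔ ‖z‖ = 1 := fun z => mem_sphere_zero_iff_norm
  let U : Set E := ⋃ r ∈ R, Metric.ball r (ε / 2)
  let V : Set E := ⋃ s ∈ {s | ‖s‖ = 1 ∧ s ∉ R}, Metric.ball s (ε / 2)
  have hsub := (isPreconnected_sphere hE 0 1).subset_left_of_subset_union (u := U) (v := V)
    (isOpen_biUnion fun _ _ => Metric.isOpen_ball) (isOpen_biUnion fun _ _ => Metric.isOpen_ball)
    (by
      rw [Set.disjoint_left]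
      intro z hzU hzV
      obtain ⟨r, hr, hzr⟩ := mem_iUnion₂.1 hzU
      obtain ⟨s, ⟨hs, hsR⟩, hzs⟩ := mem_iUnion₂.1 hzV
      rw [Metric.mem_ball] at hzr hzs
      refine hsR (hR r hr s hs ?_)
      rw [← dist_eq_norm]
      calc dist s r ≤ dist s z + dist z r := dist_triangle _ _ _
        _ < ε := by rw [dist_comm s z]; linarith)
    (fun z hz => by
      by_cases hzR : z ∈ R
      · exact Or.inl (mem_iUnion₂.2 ⟨z, hzR, Metric.mem_ball_self (half_pos hε)⟩)
      · exact Or.inr (mem_iUnion₂.2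
          ⟨z, ⟨(hsph z).1 hz, hzR⟩, Metric.mem_ball_self (half_pos hε)⟩))
    ⟨x, (hsph x).2 hx, mem_iUnion₂.2 ⟨x, hxR, Metric.mem_ball_self (half_pos hε)⟩⟩
  obtain ⟨r, hr, hyr⟩ := mem_iUnion₂.1 (hsub ((hsph y).2 hy))
  rw [Metric.mem_ball, dist_eq_norm] at hyr
  exact hR r hr y hy (by linarith)

/-- Unitaries in `S` carry the ball around `ψ` to balls of the same radius, so the radius is uniform
along the orbit. -/
theorem orbit_eq_sphere (hH : 1 < Module.rank ℝ H)
    (hS : ∀ g ∈ S, star g * g = 1 ∧ g * star g = 1)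
    {W : Submodule ℝ (Op H)} {g : Op H} (hg : g ∈ S) (hgW : IsAttained S g (W.map (conjBy g)))
    {ψ : H} (hψ : ‖ψ‖ = 1) (hW : IsSphereTransitiveAt W ψ) {φ : H} (hφ : ‖φ‖ = 1) :
    ∃ h ∈ S, φ = h ψ := by
  obtain ⟨ε, hε, hball⟩ := exists_ball_subset_orbit hS hg hgW hψ hW
  refine sphere_subset_of_uniform_ball hH (R := {φ | ∃ h ∈ S, φ = h ψ}) hψ ⟨1, one_mem _, rfl⟩ hε
    ?_ hφ
  rintro _ ⟨h, hh, rfl⟩ y hy hyr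
  have hinv : h (star h y) = y := DFunLike.congr_fun (hS h hh).2 y
  have hn := norm_apply_of_star_mul_self (hS h hh).1
  obtain ⟨h', hh', hy'⟩ := hball (star h y) (by rw [← hn, hinv, hy])
    (by rw [← hn, map_sub, hinv]; exact hyr)
  refine ⟨h * h', mul_mem hh hh', ?_⟩
  change y = h (h' ψ)
  rw [← hy', hinv]

/-- If the attainable directions are transitive at one unit vector, then `S` is transitive on the
sphere. -/
theorem exists_apply_eq_of_isSphereTransitiveAt (hH : 1 < Module.rank ℝ H)
    (hS : ∀ g ∈ S, star g * g = 1 ∧ g * star g = 1)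
    (hΓ : ∀ X ∈ Γ, ∀ t : ℝ, 0 < t → NormedSpace.exp (t • X) ∈ S)
    {ψ₀ : H} (hψ₀ : ‖ψ₀‖ = 1) (hW : IsSphereTransitiveAt (attainableSpan S Γ) ψ₀)
    {ψ φ : H} (hψ : ‖ψ‖ = 1) (hφ : ‖φ‖ = 1) : ∃ h ∈ S, φ = h ψ := by
  obtain ⟨g, hg, hgW⟩ := exists_isAttained (fun g hg => (hS g hg).1) hΓ
  -- The orbit of `ψ₀` reaches `ψ = hψ₀`; conjugation by `h` preserves the span and transports
  -- transitivity to `ψ`.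
  obtain ⟨h, hh, rfl⟩ := orbit_eq_sphere hH hS hg hgW hψ₀ hW hψ
  refine orbit_eq_sphere hH hS hg hgW hψ (fun v hv => ?_) hφ
  obtain ⟨Z, hZ, hZv⟩ := hW (star h v) (by rwa [inner_star_apply])
  refine ⟨conjBy h Z, conjBy_mem_attainableSpan hh hZ, ?_⟩
  have h1 : conjBy h Z * h = h * Z := by rw [conjBy_apply, mul_assoc, (hS h hh).1, mul_one]
  have h2 : (conjBy h Z) (h ψ₀) = h (Z ψ₀) := DFunLike.congr_fun h1 ψ₀
  rw [h2, hZv]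
  exact DFunLike.congr_fun (hS h hh).2 v

end Attainable

/-! ### Controllability from transitivity -/

section Reachability

open MeasureTheory Set Filter Topology

variable {H : Type*} [NormedAddCommGroup H] [InnerProductSpace ℂ H] [FiniteDimensional ℂ H]
  {m : ℕ}

/-- The generator `-i(H₀ + ∑ⱼ cⱼ Hⱼ)` of the evolution under the constant control `c`. -/
noncomputable def generator (H₀ : Op H) (Hc : Fin m → Op H) (c : Fin m → ℝ) : Op H :=
  (-Complex.I) • (H₀ + ∑ j, c j • Hc j)

/-- The monoid of the evolutions under piecewise constant controls. -/
noncomputable def evolutionMonoid (H₀ : Op H) (Hc : Fin m → Op H) : Submonoid (Op H) :=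
  Submonoid.closure {g | ∃ t : ℝ, 0 < t ∧ ∃ c, g = NormedSpace.exp (t • generator H₀ Hc c)}

/-- `φ` is reached from `ψ` in positive time with a piecewise constant control. -/
def IsReachable (H₀ : Op H) (Hc : Fin m → Op H) (ψ φ : H) : Prop :=
  ∃ u : ℝ → Fin m → ℝ, IsPiecewiseConstant u ∧ ∃ T : ℝ, 0 < T ∧ ∃ χ : ℝ → H,
    IsSchrodingerSolution H₀ Hc u T χ ∧
    IntervalIntegrable (fun s => generator H₀ Hc (u s) (χ s)) volume 0 T ∧ χ 0 = ψ ∧ χ T = φ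

variable {H₀ : Op H} {Hc : Fin m → Op H}

theorem isReachable_exp {t : ℝ} (ht : 0 < t) (c : Fin m → ℝ) (ψ : H) :
    IsReachable H₀ Hc ψ (NormedSpace.exp (t • generator H₀ Hc c) ψ) := by
  have : CompleteSpace H := FiniteDimensional.complete ℂ H
  set X := generator H₀ Hc c with hX
  let ev : Op H →L[ℝ] H := (ContinuousLinearMap.apply ℂ H ψ).restrictScalars ℝ
  have hd : ∀ s : ℝ, HasDerivAt (fun s : ℝ => NormedSpace.exp (s • X) ψ)
      (X (NormedSpace.exp (s • X) ψ)) s := fun s =>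
    ev.hasFDerivAt.comp_hasDerivAt s (hasDerivAt_exp_smul_const' (𝕂 := ℝ) X s)
  have hcont : Continuous fun s : ℝ => NormedSpace.exp (s • X) ψ :=
    continuous_iff_continuousAt.2 fun s => (hd s).continuousAt
  have hint : ∀ T : ℝ, IntervalIntegrable (fun s : ℝ => X (NormedSpace.exp (s • X) ψ)) volume 0 T :=
    fun T => (X.continuous.comp hcont).intervalIntegrable _ _
  refine ⟨fun _ => c, ⟨∅, fun _ _ _ _ => rfl⟩, t, ht, fun s => NormedSpace.exp (s • X) ψ,
    ⟨hcont.continuousOn, fun s _ => ?_⟩, hint t, by simp, rfl⟩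
  have h1 := intervalIntegral.integral_eq_sub_of_hasDerivAt (fun r _ => hd r) (hint s)
  change _ = _ + ∫ r in (0 : ℝ)..s, X (NormedSpace.exp (r • X) ψ)
  rw [h1]
  abel

theorem IsPiecewiseConstant.concat {u v : ℝ → Fin m → ℝ} (hu : IsPiecewiseConstant u)
    (hv : IsPiecewiseConstant v) (T : ℝ) :
    IsPiecewiseConstant fun t => if t < T then u t else v (t - T) := by
  classical
  obtain ⟨B, hB⟩ := hu
  obtain ⟨C, hC⟩ := hv
  refine ⟨insert T (B ∪ C.image (· + T)), fun s t hst h => ?_⟩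
  have hT := h T (Finset.mem_insert_self _ _)
  rw [mem_Icc, not_and_or, not_le, not_le] at hT
  rcases hT with hT | hT
  · have h1 : ¬ s < T := hT.le.not_gt
    have h2 : ¬ t < T := (hT.le.trans hst).not_gt
    simp only [h1, h2, if_false]
    refine hC _ _ (by linarith) fun b hb hbm => h (b + T) ?_ ?_
    · exact Finset.mem_insert_of_mem (Finset.mem_union_right _ (Finset.mem_image_of_mem _ hb))
    · rw [mem_Icc] at hbm ⊢
      constructor <;> linarith [hbm.1, hbm.2]
  · have h1 : s < T := hst.trans_lt hT
    simp only [h1, hT, if_true]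
    exact hB _ _ hst fun b hb => h b
      (Finset.mem_insert_of_mem (Finset.mem_union_left _ hb))

theorem IsReachable.trans {ψ φ χ : H} (h₁ : IsReachable H₀ Hc ψ φ)
    (h₂ : IsReachable H₀ Hc φ χ) : IsReachable H₀ Hc ψ χ := by
  obtain ⟨u, hu, T, hT, x, ⟨hxc, hx⟩, hxi, rfl, rfl⟩ := h₁
  obtain ⟨v, hv, S, hS, y, ⟨hyc, hy⟩, hyi, hy0, rfl⟩ := h₂
  -- The strict and the weak inequality at `T` differ at one point only; the integrands are compared
  -- on open intervals.
  set w : ℝ → Fin m → ℝ := fun t => if t < T then u t else v (t - T) with hw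
  set z : ℝ → H := fun t => if t ≤ T then x t else y (t - T) with hz
  have hz1 : ∀ t, t ≤ T → z t = x t := fun t ht => if_pos ht
  have hz2 : ∀ t, T ≤ t → z t = y (t - T) := fun t ht => by
    rcases ht.eq_or_lt with rfl | ht
    · rw [hz1 _ le_rfl, sub_self, hy0]
    · exact if_neg ht.not_ge
  -- the integrands agree on the two parts
  have e1 : ∀ t, t ≤ T → EqOn (fun s => generator H₀ Hc (w s) (z s))
      (fun s => generator H₀ Hc (u s) (x s)) (Ioo 0 t) := fun t ht s hs => by
    have hsT : s < T := hs.2.trans_le ht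
    simp only [hz1 s hsT.le, hw, hsT, if_true]
  have e2 : ∀ t, EqOn (fun s => generator H₀ Hc (w s) (z s))
      (fun s => generator H₀ Hc (v (s - T)) (y (s - T))) (Ioo T t) := fun t s hs => by
    have hsT : ¬ s < T := hs.1.le.not_gt
    simp only [hz2 s hs.1.le, hw, hsT, if_false]
  have i1 : ∀ t, 0 ≤ t → t ≤ T →
      ∫ s in (0 : ℝ)..t, generator H₀ Hc (w s) (z s) =
        ∫ s in (0 : ℝ)..t, generator H₀ Hc (u s) (x s) := fun t h0 ht =>
    intervalIntegral.integral_congr_Ioo_of_le h0 (e1 t ht)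
  have i2 : ∀ t, T ≤ t → ∫ s in T..t, generator H₀ Hc (w s) (z s) =
      ∫ s in (0 : ℝ)..(t - T), generator H₀ Hc (v s) (y s) := fun t ht => by
    rw [intervalIntegral.integral_congr_Ioo_of_le ht (e2 t),
      intervalIntegral.integral_comp_sub_right (fun s => generator H₀ Hc (v s) (y s)) T, sub_self]
  have j1 : IntervalIntegrable (fun s => generator H₀ Hc (w s) (z s)) volume 0 T :=
    (intervalIntegrable_congr_uIoo (by rw [uIoo_of_le hT.le]; exact e1 T le_rfl)).2 hxi
  have j2 : ∀ t, T ≤ t → t ≤ T + S →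
      IntervalIntegrable (fun s => generator H₀ Hc (w s) (z s)) volume T t := fun t ht ht' => by
    have h3 : IntervalIntegrable (fun s => generator H₀ Hc (v s) (y s)) volume 0 (t - T) :=
      hyi.mono_set (uIcc_subset_uIcc left_mem_uIcc
        (by rw [uIcc_of_le hS.le]; constructor <;> linarith))
    have h4 := h3.comp_sub_right T
    rw [zero_add, sub_add_cancel] at h4
    exact (intervalIntegrable_congr_uIoo (by rw [uIoo_of_le ht]; exact e2 t)).2 h4
  refine ⟨w, hu.concat hv T, T + S, by linarith, z, ⟨?_, fun t ht => ?_⟩,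
    j1.trans (j2 (T + S) (by linarith) le_rfl), hz1 0 hT.le, by
      rw [hz2 _ (by linarith), add_sub_cancel_left]⟩
  · have hU : Icc 0 (T + S) = Icc 0 T ∪ Icc T (T + S) :=
      (Icc_union_Icc_eq_Icc hT.le (by linarith)).symm
    rw [hU]
    refine ContinuousOn.union_of_isClosed ?_ ?_ isClosed_Icc isClosed_Icc
    · exact hxc.congr fun t ht => hz1 t ht.2
    · have h5 : ContinuousOn (fun t => y (t - T)) (Icc T (T + S)) :=
        hyc.comp (continuous_id.sub continuous_const).continuousOn fun t ht => by
          rw [mem_Icc] at ht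
          constructor <;> simp <;> linarith [ht.1, ht.2]
      exact h5.congr fun t ht => hz2 t ht.1
  · change z t = z 0 + ∫ s in (0 : ℝ)..t, generator H₀ Hc (w s) (z s)
    rw [hz1 0 hT.le]
    rcases le_total t T with h | h
    · rw [i1 t ht.1 h, hz1 t h]
      exact hx t ⟨ht.1, h⟩
    · rw [← intervalIntegral.integral_add_adjacent_intervals j1 (j2 t h ht.2), i1 T hT.le le_rfl,
        i2 t h, ← add_assoc, hz2 t h]
      have h6 : x T = x 0 + ∫ s in (0 : ℝ)..T, generator H₀ Hc (u s) (x s) :=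
        hx T ⟨hT.le, le_rfl⟩
      rw [← h6, ← hy0]
      exact hy (t - T) ⟨by linarith, by linarith [ht.2]⟩

/-- The initial reachability `h` provides the positive time, since the identity of the monoid takes
none. -/
theorem IsReachable.apply {ψ φ : H} (h : IsReachable H₀ Hc ψ φ) {g : Op H}
    (hg : g ∈ evolutionMonoid H₀ Hc) : IsReachable H₀ Hc ψ (g φ) := by
  induction hg using Submonoid.closure_induction generalizing φ with
  | mem g hg =>
    obtain ⟨t, ht, c, rfl⟩ := hg
    exact h.trans (isReachable_exp ht c φ)
  | one => exact h
  | mul g₁ g₂ _ _ ih₁ ih₂ => exact ih₁ (ih₂ h)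

theorem star_generator (hH₀ : IsSelfAdjoint H₀) (hHc : ∀ j, IsSelfAdjoint (Hc j))
    (c : Fin m → ℝ) : star (generator H₀ Hc c) = -generator H₀ Hc c :=
  dynamicalAlgebra_le_skewAlgebra hH₀ hHc (generator_mem_dynamicalAlgebra c)

theorem star_mul_self_of_mem_evolutionMonoid (hH₀ : IsSelfAdjoint H₀)
    (hHc : ∀ j, IsSelfAdjoint (Hc j)) {g : Op H} (hg : g ∈ evolutionMonoid H₀ Hc) :
    star g * g = 1 ∧ g * star g = 1 := by
  induction hg using Submonoid.closure_induction with
  | mem g hg =>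
    obtain ⟨t, -, c, rfl⟩ := hg
    rw [exp_smul_star (star_generator hH₀ hHc c)]
    refine ⟨exp_neg_mul_exp _, ?_⟩
    have h := exp_neg_mul_exp (-(t • generator H₀ Hc c))
    rwa [neg_neg] at h
  | one => simp
  | mul g₁ g₂ _ _ ih₁ ih₂ =>
    constructor
    · rw [star_mul, mul_assoc, ← mul_assoc (star g₁), ih₁.1, one_mul, ih₂.1]
    · rw [star_mul, mul_assoc, ← mul_assoc g₂, ih₂.2, one_mul, ih₁.2]

theorem exp_generator_mem_evolutionMonoid {X : Op H} (hX : X ∈ range (generator H₀ Hc)) (t : ℝ)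
    (ht : 0 < t) : NormedSpace.exp (t • X) ∈ evolutionMonoid H₀ Hc := by
  obtain ⟨c, rfl⟩ := hX
  exact Submonoid.subset_closure ⟨t, ht, c, rfl⟩

/-- The operators of `W` whose commutator with `W` stays in `W`. -/
def normalizerIn (W : Submodule ℝ (Op H)) : LieSubalgebra ℝ (Op H) where
  carrier := {X | X ∈ W ∧ ∀ Z ∈ W, X * Z - Z * X ∈ W}
  zero_mem' := ⟨zero_mem _, fun Z _ => by simp⟩
  add_mem' {X Y} hX hY := ⟨add_mem hX.1 hY.1, fun Z hZ => by
    have e : (X + Y) * Z - Z * (X + Y) = (X * Z - Z * X) + (Y * Z - Z * Y) := by noncomm_ring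
    rw [e]
    exact add_mem (hX.2 Z hZ) (hY.2 Z hZ)⟩
  smul_mem' c {X} hX := ⟨W.smul_mem c hX.1, fun Z hZ => by
    rw [smul_mul_assoc, mul_smul_comm, ← smul_sub]
    exact W.smul_mem c (hX.2 Z hZ)⟩
  lie_mem' {X Y} hX hY := ⟨hX.2 Y hY.1, fun Z hZ => by
    have e : ⁅X, Y⁆ * Z - Z * ⁅X, Y⁆ = (X * (Y * Z - Z * Y) - (Y * Z - Z * Y) * X) -
        (Y * (X * Z - Z * X) - (X * Z - Z * X) * Y) := by
      rw [Ring.lie_def]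
      noncomm_ring
    rw [e]
    exact sub_mem (hX.2 _ (hY.2 Z hZ)) (hY.2 _ (hX.2 Z hZ))⟩

/-- The span itself need not be a Lie algebra, but the elements in it that normalize it form one by
the Jacobi identity, and it contains all generators. -/
theorem dynamicalAlgebra_le_attainableSpan (hH₀ : IsSelfAdjoint H₀)
    (hHc : ∀ j, IsSelfAdjoint (Hc j)) {X : Op H} (hX : X ∈ dynamicalAlgebra H₀ Hc) :
    X ∈ attainableSpan (evolutionMonoid H₀ Hc) (range (generator H₀ Hc)) := by
  set W := attainableSpan (evolutionMonoid H₀ Hc) (range (generator H₀ Hc))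
  have hgen : ∀ c, generator H₀ Hc c ∈ normalizerIn W := fun c =>
    ⟨subset_attainableSpan (mem_range_self c), fun Z hZ =>
      commutator_mem_attainableSpan (fun X hX => exp_generator_mem_evolutionMonoid hX)
        (mem_range_self c) (star_generator hH₀ hHc c) hZ⟩
  have h0 : generator H₀ Hc 0 = (-Complex.I) • H₀ := by simp [generator]
  have hle : dynamicalAlgebra H₀ Hc ≤ normalizerIn W := by
    refine LieSubalgebra.lieSpan_le.2 (insert_subset ?_ ?_)
    · rw [← h0]
      exact hgen 0
    · rintro _ ⟨j, rfl⟩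
      have h1 : (-Complex.I) • Hc j = generator H₀ Hc (Pi.single j 1) - generator H₀ Hc 0 := by
        rw [h0, generator, ← smul_sub, add_sub_cancel_left, Finset.sum_eq_single j]
        · simp
        · intro i _ hij
          simp [hij]
        · simp
      change (-Complex.I) • Hc j ∈ normalizerIn W
      rw [h1]
      exact sub_mem (hgen _) (hgen _)
  exact (hle hX).1

/-- If the dynamical algebra moves one unit vector in all directions tangent to the sphere, then
the system is controllable. -/
theorem pureStateControllable_of_transitive (hn : 2 ≤ Module.finrank ℂ H)
    (hH₀ : IsSelfAdjoint H₀) (hHc : ∀ j, IsSelfAdjoint (Hc j)) {𝒰 : Set (ℝ → Fin m → ℝ)}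
    (h𝒰 : ∀ u, IsPiecewiseConstant u → u ∈ 𝒰) {ψ₀ : H} (hψ₀ : ‖ψ₀‖ = 1)
    (h : ∀ v, (inner ℂ ψ₀ v).re = 0 → ∃ T ∈ dynamicalAlgebra H₀ Hc, T ψ₀ = v) :
    PureStateControllable 𝒰 H₀ Hc := by
  intro ψ φ hψ hφ
  have hrank : 1 < Module.rank ℝ H := by
    have h1 : 1 < Module.finrank ℝ H := by
      rw [finrank_real_of_complex]
      omega
    simpa using Module.lt_rank_of_lt_finrank h1
  have hS := fun g (hg : g ∈ evolutionMonoid H₀ Hc) =>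
    star_mul_self_of_mem_evolutionMonoid hH₀ hHc hg
  -- An initial unit of time under zero control keeps the total time positive even when the
  -- evolution found next is the identity.
  have h1 := isReachable_exp (H₀ := H₀) (Hc := Hc) one_pos 0 ψ
  have hg : NormedSpace.exp ((1 : ℝ) • generator H₀ Hc 0) ∈ evolutionMonoid H₀ Hc :=
    exp_generator_mem_evolutionMonoid (mem_range_self _) 1 one_pos
  obtain ⟨g, hg, rfl⟩ := exists_apply_eq_of_isSphereTransitiveAt hrank hS
    (fun X hX => exp_generator_mem_evolutionMonoid hX) hψ₀ (fun v hv => by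
      obtain ⟨T, hT, hTv⟩ := h v hv
      exact ⟨T, dynamicalAlgebra_le_attainableSpan hH₀ hHc hT, hTv⟩)
    (ψ := NormedSpace.exp ((1 : ℝ) • generator H₀ Hc 0) ψ)
    (by rw [norm_apply_of_star_mul_self (hS _ hg).1, hψ]) hφ
  obtain ⟨u, hu, T, hT, χ, hχ, -, h0, hχT⟩ := h1.apply hg
  exact ⟨u, h𝒰 u hu, T, hT, χ, hχ, h0, hχT⟩

end Reachability

/-! ### The linear vector fields on the projective space -/

section LinearFields

variable {H : Type*} [NormedAddCommGroup H] [InnerProductSpace ℂ H] [FiniteDimensional ℂ H]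

/-- The map `q ↦ T q - q T` on operators. -/
noncomputable def adMap (T : Op H) : Op H →L[ℝ] Op H :=
  ContinuousLinearMap.mul ℝ (Op H) T - (ContinuousLinearMap.mul ℝ (Op H)).flip T

theorem adMap_apply (T q : Op H) : adMap T q = T * q - q * T := rfl

theorem adMap_eq_tangentOf {T : Op H} (p : PureState H) :
    adMap T p.op = tangentOf p (Complex.I • T) := by
  rw [adMap_apply, tangentOf, smul_mul_assoc, mul_smul_comm, ← smul_sub, smul_smul]
  simp

theorem isSelfAdjoint_I_smul {T : Op H} (hT : star T = -T) : IsSelfAdjoint (Complex.I • T) := by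
  rw [IsSelfAdjoint, star_smul, hT, Complex.star_def, Complex.conj_I, neg_smul_neg]

theorem adMap_mem_tangentSpace {T : Op H} (hT : star T = -T) (p : PureState H) :
    adMap T p.op ∈ tangentSpace p :=
  ⟨Complex.I • T, isSelfAdjoint_I_smul hT, adMap_eq_tangentOf p⟩

/-- The vector field `q ↦ T q - q T` on `P(H)` defined by a skew-adjoint operator. -/
noncomputable def skewField (T : Op H) (hT : star T = -T) : SmoothVF H :=
  ⟨fun p => ⟨adMap T p.op, adMap_mem_tangentSpace hT p⟩,
    ⟨fun q => adMap T q, (adMap T).contDiff, fun _ => rfl⟩⟩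

/-- The linear map sending a skew-adjoint operator to its vector field. -/
noncomputable def linField : skewAlgebra H →ₗ[ℝ] SmoothVF H where
  toFun T := skewField T.1 (mem_skewAlgebra.1 T.2)
  map_add' S T := opAt_ext fun p => by
    change adMap ((S : Op H) + (T : Op H)) p.op = adMap (S : Op H) p.op + adMap (T : Op H) p.op
    simp only [adMap_apply]
    noncomm_ring
  map_smul' c T := opAt_ext fun p => by
    change adMap (c • (T : Op H)) p.op = c • adMap (T : Op H) p.op
    simp only [adMap_apply, smul_mul_assoc, mul_smul_comm, smul_sub]

theorem opAt_linField (T : skewAlgebra H) (p : PureState H) :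
    opAt (linField T) p = adMap T p.op := rfl

/-- The order reverses: for linear fields the bracket is the derivative of the second along the
first minus the opposite one, which is the negative of the operator commutator. -/
theorem lie_linField (S T : skewAlgebra H) : ⁅linField S, linField T⁆ = linField ⁅T, S⁆ :=
  opAt_ext fun p => by
    rw [bracket_val_eq (adMap (S : Op H)).contDiff (fun _ => rfl) (adMap (T : Op H)).contDiff
      (fun _ => rfl), VectorField.lieBracket_eq, opAt_linField]
    simp only [ContinuousLinearMap.fderiv]
    change adMap (T : Op H) (adMap (S : Op H) p.op) - adMap (S : Op H) (adMap (T : Op H) p.op) =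
      adMap ((T : Op H) * (S : Op H) - (S : Op H) * (T : Op H)) p.op
    simp only [adMap_apply]
    noncomm_ring

/-- The flow is conjugation by unitaries, which preserves traces of products. Infinitesimally, the
defect in the Killing equation is the trace of a commutator with `T`. -/
theorem isKilling_linField (κ : ℝ) (T : skewAlgebra H) : IsKilling κ (linField T) := by
  intro Y Z p
  obtain ⟨G, hG, hGY⟩ := exists_ext Y
  obtain ⟨K, hK, hKZ⟩ := exists_ext Z
  have hY : ∀ q, ((Y.1 q : tangentSpace q) : Op H) = G q.op := fun q => (hGY q).symm
  have hZ : ∀ q, ((Z.1 q : tangentSpace q) : Op H) = K q.op := fun q => (hKZ q).symm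
  let τ : Op H →L[ℝ] ℝ := LinearMap.toContinuousLinearMap
    (Complex.reLm ∘ₗ (((κ : ℂ) • (tr : Op H →ₗ[ℂ] ℂ)).restrictScalars ℝ))
  have hτ : ∀ A B : Op H, τ (A * B) = τ (B * A) := fun A B => by
    change (κ * tr (A * B)).re = (κ * tr (B * A)).re
    rw [tr_mul_comm]
  have hfs : ∀ (q : PureState H) (u v : tangentSpace q), fubiniStudy κ q u v =
      τ (q.op * ((u : Op H) * v + v * u)) := fun _ _ _ => rfl
  have hGd := (hG.differentiable (by simp) p.op).hasFDerivAt
  have hKd := (hK.differentiable (by simp) p.op).hasFDerivAt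
  have hφ : ContDiff ℝ ∞ fun q : Op H => τ (q * (G q * K q + K q * G q)) :=
    τ.contDiff.comp (contDiff_id.mul ((hG.mul hK).add (hK.mul hG)))
  have hd := τ.hasFDerivAt.comp p.op
    ((hasFDerivAt_id (𝕜 := ℝ) p.op).mul' ((hGd.mul' hKd).add (hKd.mul' hGd)))
  rw [dirDeriv_eq hφ (fun q => by rw [hfs, hY, hZ])]
  have hval : ∀ {W : SmoothVF H} {F : Op H → Op H}, ContDiff ℝ ∞ F → (∀ q, F q.op = opAt W q) →
      (((⁅linField T, W⁆ : SmoothVF H).1 p : tangentSpace p) : Op H) =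
        fderiv ℝ F p.op (adMap T p.op) - adMap T (F p.op) := fun {W F} hF hFW => by
    refine (bracket_val_eq (adMap (T : Op H)).contDiff (fun _ => rfl) hF hFW p).trans ?_
    rw [VectorField.lieBracket_eq]
    simp only [ContinuousLinearMap.fderiv]
  have hd' : fderiv ℝ (fun q : Op H => τ (q * (G q * K q + K q * G q))) p.op
      (((linField T).1 p : tangentSpace p) : Op H) =
      τ (p.op * ((G p.op * fderiv ℝ K p.op (adMap T p.op) +
        fderiv ℝ G p.op (adMap T p.op) * K p.op) +
        (K p.op * fderiv ℝ G p.op (adMap T p.op) + fderiv ℝ K p.op (adMap T p.op) * G p.op)) +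
        adMap T p.op * (G p.op * K p.op + K p.op * G p.op)) :=
    DFunLike.congr_fun hd.fderiv _
  rw [hd', hfs, hfs, hval hG hGY, hval hK hKZ, hY, hZ, ← map_add, ← sub_eq_zero, ← map_sub]
  generalize fderiv ℝ G p.op (adMap T p.op) = g
  generalize fderiv ℝ K p.op (adMap T p.op) = k
  generalize G p.op = A
  generalize K p.op = B
  simp only [adMap_apply]
  have e : p.op * (A * k + g * B + (B * g + k * A)) +
      ((T : Op H) * p.op - p.op * T) * (A * B + B * A) -
      (p.op * ((g - (T * A - A * T)) * B + B * (g - (T * A - A * T))) +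
        p.op * (A * (k - (T * B - B * T)) + (k - (T * B - B * T)) * A)) =
      T * (p.op * (A * B + B * A)) - (p.op * (A * B + B * A)) * T := by
    noncomm_ring
  rw [e, map_sub, hτ, sub_self]

theorem dirDeriv_observable (κ : ℝ) (A : Op H) (p : PureState H) (v : tangentSpace p) :
    dirDeriv (observable κ A) p v = (κ * tr (A * (v : Op H))).re := by
  let τ : Op H →L[ℝ] ℝ := LinearMap.toContinuousLinearMap
    (Complex.reLm ∘ₗ (((κ : ℂ) • (tr : Op H →ₗ[ℂ] ℂ)).restrictScalars ℝ))
  let σ : Op H →L[ℝ] ℝ := τ ∘L ContinuousLinearMap.mul ℝ (Op H) A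
  let c : ℝ := ((1 - κ) / (Module.finrank ℂ H) * tr A : ℂ).re
  have h := dirDeriv_eq (f := observable κ A) (G := fun q => σ q + c)
    (σ.contDiff.add contDiff_const) (fun q => (Complex.add_re _ _).symm) p v
  rw [h, fderiv_add_const, ContinuousLinearMap.fderiv]
  rfl

theorem symplecticForm_sub_left (κ : ℝ) (p : PureState H) (u u' v : tangentSpace p) :
    symplecticForm κ p (u - u') v = symplecticForm κ p u v - symplecticForm κ p u' v := by
  simp only [symplecticForm, Submodule.coe_sub, sub_mul, mul_sub, map_sub, Complex.sub_re]
  ring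

/-- Nondegeneracy comes from testing against the rotated vector `-i[u, p]`: the value is `-2κ
tr((up)*(up))`. Thus `up = 0`, its adjoint gives `pu = 0`, and `u = up + pu`. -/
theorem eq_zero_of_symplecticForm_eq_zero {κ : ℝ} (hκ : κ ≠ 0) {p : PureState H}
    {u : tangentSpace p} (h : ∀ v, symplecticForm κ p u v = 0) : u = 0 := by
  obtain ⟨u, hu⟩ := u
  have hu' := (mem_tangentSpace_iff p u).1 hu
  have hpp : p.op * p.op = p.op := p.2.2.1
  have hps : star p.op = p.op := p.2.1
  have hpup := mul_tangent_mul hpp hu'.2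
  have h1 := h ⟨tangentOf p u, u, hu'.1, rfl⟩
  have h2 : tr (p.op * (u * tangentOf p u - tangentOf p u * u)) =
      -(2 * Complex.I) * tr (star (u * p.op) * (u * p.op)) := by
    have e : p.op * (u * tangentOf p u - tangentOf p u * u) =
        (-Complex.I) • (p.op * u * u * p.op + p.op * p.op * u * u
          - (p.op * u * p.op) * u - (p.op * u * p.op) * u) := by
      simp only [tangentOf, smul_mul_assoc, mul_smul_comm, ← smul_sub]
      congr 1
      noncomm_ring
    have e2 : star (u * p.op) * (u * p.op) = p.op * u * u * p.op := by
      rw [star_mul, hps, hu'.1.star_eq]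
      noncomm_ring
    have e3 : tr (p.op * u * u * p.op) = tr (p.op * u * u) := by
      rw [tr_mul_comm, ← mul_assoc, ← mul_assoc, hpp]
    rw [e, hpup, e2, hpp, map_smul, zero_mul, sub_zero, sub_zero, map_add, e3, smul_eq_mul]
    ring
  have h3 : (tr (star (u * p.op) * (u * p.op))).re = 0 := by
    change (-Complex.I * κ * tr (p.op * (u * tangentOf p u - tangentOf p u * u))).re = 0 at h1
    rw [h2] at h1
    have e : -Complex.I * κ * (-(2 * Complex.I) * tr (star (u * p.op) * (u * p.op))) =
        ((-2 * κ : ℝ) : ℂ) * tr (star (u * p.op) * (u * p.op)) := by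
      push_cast
      linear_combination 2 * (κ : ℂ) * tr (star (u * p.op) * (u * p.op)) * Complex.I_mul_I
    rw [e, Complex.re_ofReal_mul] at h1
    exact (mul_eq_zero.1 h1).resolve_left (mul_ne_zero (by norm_num) hκ)
  have h4 : (tr (star (u * p.op) * (u * p.op))).im = 0 := by
    rw [← Complex.conj_eq_iff_im, ← tr_star, star_mul, star_star]
  have h5 : u * p.op = 0 := eq_zero_of_tr_star_mul_self_eq_zero (Complex.ext h3 h4)
  have h6 : p.op * u = 0 := by
    have h7 := congrArg star h5
    rwa [star_mul, hps, hu'.1.star_eq, star_zero] at h7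
  refine Subtype.ext ?_
  change u = 0
  rw [← hu'.2, h5, h6, add_zero]

/-- The linear field of `-iA` satisfies the Hamilton equation by cyclicity of the trace, and
nondegeneracy makes the solution unique. -/
theorem isHamiltonianVF_observable_iff {κ : ℝ} (hκ : κ ≠ 0) {A : Op H} (hA : IsSelfAdjoint A)
    (X : SmoothVF H) : IsHamiltonianVF κ (observable κ A) X ↔
      X = linField ⟨(-Complex.I) • A, neg_I_smul_mem_skewAlgebra hA⟩ := by
  set Y := linField ⟨(-Complex.I) • A, neg_I_smul_mem_skewAlgebra hA⟩ with hYdef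
  have hY : IsHamiltonianVF κ (observable κ A) Y := by
    intro p v
    obtain ⟨B, hB, hv⟩ := v.2
    have hYp : ((Y.1 p : tangentSpace p) : Op H) = tangentOf p A := by
      have h := adMap_eq_tangentOf (T := (-Complex.I) • A) p
      have e : Complex.I • (-Complex.I) • A = A := by
        rw [smul_smul]
        simp
      rw [e] at h
      exact h
    rw [symplecticForm_tangentOf κ p _ _ A B hYp hv, dirDeriv_observable, hv, tangentOf,
      mul_smul_comm, map_smul, mul_sub, mul_sub, map_sub, map_sub, smul_eq_mul]
    have e1 : tr (A * (B * p.op)) = tr (p.op * (A * B)) := by rw [← mul_assoc, tr_mul_comm]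
    have e2 : tr (A * (p.op * B)) = tr (p.op * (B * A)) := by rw [tr_mul_comm, mul_assoc]
    rw [e1, e2]
    congr 1
    ring
  constructor
  · intro hX
    refine Subtype.ext (funext fun p => sub_eq_zero.1 ?_)
    refine eq_zero_of_symplecticForm_eq_zero hκ fun v => ?_
    rw [symplecticForm_sub_left, hX p v, hY p v, sub_self]
  · rintro rfl
    exact hY

/-! ### The accessibility algebra as the image of the dynamical algebra -/

variable {m : ℕ} {H₀ : Op H} {Hc : Fin m → Op H}

/-- The accessibility algebra consists of the linear fields of the dynamical algebra. -/
theorem mem_accessibilityAlgebra_iff {κ : ℝ} (hκ : κ ≠ 0) (hH₀ : IsSelfAdjoint H₀)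
    (hHc : ∀ j, IsSelfAdjoint (Hc j)) (X : SmoothVF H) :
    X ∈ accessibilityAlgebra κ H₀ Hc ↔
      ∃ T : skewAlgebra H, (T : Op H) ∈ dynamicalAlgebra H₀ Hc ∧ linField T = X := by
  constructor
  -- The linear fields of the dynamical algebra form a Lie algebra that contains the generating
  -- fields.
  · let C : LieSubalgebra ℝ (SmoothVF H) :=
      { carrier := {X | ∃ T : skewAlgebra H, (T : Op H) ∈ dynamicalAlgebra H₀ Hc ∧ linField T = X}
        zero_mem' := ⟨0, zero_mem _, map_zero _⟩
        add_mem' := by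
          rintro _ _ ⟨S, hS, rfl⟩ ⟨T, hT, rfl⟩
          exact ⟨S + T, add_mem hS hT, map_add _ _ _⟩
        smul_mem' := by
          rintro c _ ⟨T, hT, rfl⟩
          exact ⟨c • T, (dynamicalAlgebra H₀ Hc).smul_mem c hT, map_smul _ _ _⟩
        lie_mem' := by
          rintro _ _ ⟨S, hS, rfl⟩ ⟨T, hT, rfl⟩
          exact ⟨⁅T, S⁆, (dynamicalAlgebra H₀ Hc).lie_mem hT hS, (lie_linField S T).symm⟩ }
    have hle : accessibilityAlgebra κ H₀ Hc ≤ C := by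
      refine LieSubalgebra.lieSpan_le.2 ?_
      rintro Y (hY | ⟨j, hY⟩)
      · rw [isHamiltonianVF_observable_iff hκ hH₀] at hY
        exact ⟨_, LieSubalgebra.subset_lieSpan (Set.mem_insert _ _), hY.symm⟩
      · rw [isHamiltonianVF_observable_iff hκ (hHc j)] at hY
        exact ⟨_, LieSubalgebra.subset_lieSpan (Set.mem_insert_of_mem _ (Set.mem_range_self j)),
          hY.symm⟩
    exact fun hX => hle hX
  -- Conversely, the operators whose linear field is accessible form a Lie algebra that contains the
  -- generators.
  · let D : LieSubalgebra ℝ (Op H) :=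
      { carrier := {T | ∃ h : T ∈ skewAlgebra H, linField ⟨T, h⟩ ∈ accessibilityAlgebra κ H₀ Hc}
        zero_mem' := ⟨zero_mem _, by
          have h : linField (0 : skewAlgebra H) = 0 := map_zero _
          exact h ▸ zero_mem (accessibilityAlgebra κ H₀ Hc)⟩
        add_mem' := by
          rintro S T ⟨hS, hS'⟩ ⟨hT, hT'⟩
          refine ⟨add_mem hS hT, ?_⟩
          have h : linField ((⟨S, hS⟩ : skewAlgebra H) + ⟨T, hT⟩) = _ := map_add _ _ _
          exact h ▸ add_mem hS' hT'
        smul_mem' := by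
          rintro c T ⟨hT, hT'⟩
          refine ⟨(skewAlgebra H).smul_mem c hT, ?_⟩
          have h : linField (c • (⟨T, hT⟩ : skewAlgebra H)) = _ := map_smul _ _ _
          exact h ▸ (accessibilityAlgebra κ H₀ Hc).smul_mem c hT'
        lie_mem' := by
          rintro S T ⟨hS, hS'⟩ ⟨hT, hT'⟩
          refine ⟨(skewAlgebra H).lie_mem hS hT, ?_⟩
          have h := lie_linField (⟨T, hT⟩ : skewAlgebra H) ⟨S, hS⟩
          exact h ▸ (accessibilityAlgebra κ H₀ Hc).lie_mem hT' hS' }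
    have hle : dynamicalAlgebra H₀ Hc ≤ D := by
      refine LieSubalgebra.lieSpan_le.2 (Set.insert_subset ?_ ?_)
      · exact ⟨neg_I_smul_mem_skewAlgebra hH₀, LieSubalgebra.subset_lieSpan
          (Or.inl ((isHamiltonianVF_observable_iff hκ hH₀ _).2 rfl))⟩
      · rintro _ ⟨j, rfl⟩
        exact ⟨neg_I_smul_mem_skewAlgebra (hHc j), LieSubalgebra.subset_lieSpan
          (Or.inr ⟨j, (isHamiltonianVF_observable_iff hκ (hHc j) _).2 rfl⟩)⟩
    rintro ⟨T, hT, rfl⟩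
    obtain ⟨h, h'⟩ := hle hT
    exact h'

theorem finiteDimensional_accessibilityAlgebra {κ : ℝ} (hκ : κ ≠ 0) (hH₀ : IsSelfAdjoint H₀)
    (hHc : ∀ j, IsSelfAdjoint (Hc j)) :
    FiniteDimensional ℝ (accessibilityAlgebra κ H₀ Hc) := by
  have : FiniteDimensional ℝ (skewAlgebra H) :=
    FiniteDimensional.finiteDimensional_submodule (skewAlgebra H).toSubmodule
  have hle : (accessibilityAlgebra κ H₀ Hc).toSubmodule ≤ LinearMap.range (linField (H := H)) :=
    fun X hX => by
      obtain ⟨T, -, rfl⟩ := (mem_accessibilityAlgebra_iff hκ hH₀ hHc X).1 hX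
      exact LinearMap.mem_range_self _ T
  exact Submodule.finiteDimensional_of_le hle

/-! ### Dimensions -/

/-- `K` needs to agree with the kernel only on `C`: a field vanishing at `p` lies in `A_p` only if
it is also Killing. -/
theorem finrank_eq_finrank_map_add {V W : Type*} [AddCommGroup V] [Module ℝ V] [AddCommGroup W]
    [Module ℝ W] (C K : Submodule ℝ V) [FiniteDimensional ℝ C] (f : V →ₗ[ℝ] W)
    (h : ∀ x ∈ C, x ∈ K ↔ f x = 0) :
    Module.finrank ℝ C = Module.finrank ℝ (C.map f) + Module.finrank ℝ ↥(C ⊓ K) := by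
  have h1 : C ⊓ K = (LinearMap.ker (f.domRestrict C)).map C.subtype := by
    ext x
    constructor
    · rintro ⟨hx, hx'⟩
      exact ⟨⟨x, hx⟩, (h x hx).1 hx', rfl⟩
    · rintro ⟨⟨y, hy⟩, hy', rfl⟩
      exact ⟨hy, (h y hy).2 hy'⟩
  rw [h1, Submodule.finrank_map_subtype_eq, ← LinearMap.range_domRestrict,
    LinearMap.finrank_range_add_finrank_ker]

/-- The directions at `p` of the dynamical algebra. -/
noncomputable def directionsAt (L : LieSubalgebra ℝ (Op H)) (p : PureState H) :
    Submodule ℝ (Op H) :=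
  L.toSubmodule.map (-(adMap p.op : Op H →ₗ[ℝ] Op H))

theorem mem_directionsAt {L : LieSubalgebra ℝ (Op H)} {p : PureState H} {v : Op H} :
    v ∈ directionsAt L p ↔ ∃ T ∈ L, adMap T p.op = v := by
  have e : ∀ T : Op H, (-(adMap p.op : Op H →ₗ[ℝ] Op H)) T = adMap T p.op := fun T => by
    change -(p.op * T - T * p.op) = T * p.op - p.op * T
    abel
  constructor
  · rintro ⟨T, hT, rfl⟩
    exact ⟨T, hT, (e T).symm⟩
  · rintro ⟨T, hT, rfl⟩
    exact ⟨T, hT, e T⟩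

theorem finrank_dynamicalAlgebra (hH₀ : IsSelfAdjoint H₀) (hHc : ∀ j, IsSelfAdjoint (Hc j))
    (p : PureState H) : Module.finrank ℝ (dynamicalAlgebra H₀ Hc) =
      Module.finrank ℝ (directionsAt (dynamicalAlgebra H₀ Hc) p) +
      Module.finrank ℝ ↥(dynamicalAlgebra H₀ Hc ⊓ centralizerOf p) := by
  refine finrank_eq_finrank_map_add (dynamicalAlgebra H₀ Hc).toSubmodule
    (centralizerOf p).toSubmodule (-(adMap p.op : Op H →ₗ[ℝ] Op H)) fun T hT => ?_
  have hs := dynamicalAlgebra_le_skewAlgebra hH₀ hHc hT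
  have e : (-(adMap p.op : Op H →ₗ[ℝ] Op H)) T = T * p.op - p.op * T := by
    change -(p.op * T - T * p.op) = T * p.op - p.op * T
    abel
  have e' : ⁅T, Complex.I • p.op⁆ = Complex.I • (T * p.op - p.op * T) := by
    rw [Ring.lie_def, mul_smul_comm, smul_mul_assoc, smul_sub]
  rw [e]
  change (star T = -T ∧ ⁅T, Complex.I • p.op⁆ = 0) ↔ _
  rw [e', smul_eq_zero_iff_right Complex.I_ne_zero]
  exact and_iff_right hs

/-- Evaluation of a vector field at `p`. -/
noncomputable def evalAt (p : PureState H) : SmoothVF H →ₗ[ℝ] Op H where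
  toFun X := opAt X p
  map_add' X Y := opAt_add X Y p
  map_smul' c X := opAt_smul c X p

theorem finrank_accessibilityAlgebra {κ : ℝ} (hκ : κ ≠ 0) (hH₀ : IsSelfAdjoint H₀)
    (hHc : ∀ j, IsSelfAdjoint (Hc j)) (p : PureState H) :
    Module.finrank ℝ (accessibilityAlgebra κ H₀ Hc) =
      Module.finrank ℝ (directionsAt (dynamicalAlgebra H₀ Hc) p) +
      Module.finrank ℝ ↥(accessibilityAlgebra κ H₀ Hc ⊓ vanishingKilling κ p) := by
  have : FiniteDimensional ℝ (accessibilityAlgebra κ H₀ Hc).toSubmodule :=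
    finiteDimensional_accessibilityAlgebra hκ hH₀ hHc
  have hmap : directionsAt (dynamicalAlgebra H₀ Hc) p =
      (accessibilityAlgebra κ H₀ Hc).toSubmodule.map (evalAt p) := by
    ext v
    rw [mem_directionsAt]
    constructor
    · rintro ⟨T, hT, rfl⟩
      exact ⟨linField ⟨T, dynamicalAlgebra_le_skewAlgebra hH₀ hHc hT⟩,
        (mem_accessibilityAlgebra_iff hκ hH₀ hHc _).2 ⟨_, hT, rfl⟩, rfl⟩
    · rintro ⟨X, hX, rfl⟩
      obtain ⟨T, hT, rfl⟩ := (mem_accessibilityAlgebra_iff hκ hH₀ hHc X).1 hX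
      exact ⟨T, hT, rfl⟩
  rw [hmap]
  refine finrank_eq_finrank_map_add (accessibilityAlgebra κ H₀ Hc).toSubmodule
    (vanishingKilling κ p).toSubmodule (evalAt p) fun X hX => ?_
  obtain ⟨T, hT, rfl⟩ := (mem_accessibilityAlgebra_iff hκ hH₀ hHc X).1 hX
  change (IsKilling κ (linField T) ∧ (linField T).1 p = 0) ↔ (((linField T).1 p : _) : Op H) = 0
  rw [ZeroMemClass.coe_eq_zero]
  exact and_iff_right (isKilling_linField κ T)

/-! ### Pure states as unit vectors -/

theorem PureState.exists_eq_rankOne (p : PureState H) :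
    ∃ ψ : H, ‖ψ‖ = 1 ∧ p.op = rankOne ℂ ψ ψ := by
  obtain ⟨p, hps, hpp, htr⟩ := p
  change ∃ ψ : H, ‖ψ‖ = 1 ∧ p = rankOne ℂ ψ ψ
  have hp0 : p ≠ 0 := by
    rintro rfl
    simp at htr
  obtain ⟨x, hx⟩ : ∃ x, p x ≠ 0 := by
    by_contra! h
    exact hp0 (ContinuousLinearMap.ext h)
  set ψ : H := ((‖p x‖⁻¹ : ℝ) : ℂ) • p x with hψdef
  have hψ : ‖ψ‖ = 1 := by
    rw [hψdef, norm_smul, Complex.norm_real, norm_inv, norm_norm, inv_mul_cancel₀ (by simpa using hx)]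
  have hpψ : p ψ = ψ := by
    rw [hψdef, map_smul]
    congr 1
    exact DFunLike.congr_fun hpp x
  have hψψ : inner ℂ ψ ψ = 1 := by rw [inner_self_eq_norm_sq_to_K, hψ]; simp
  refine ⟨ψ, hψ, sub_eq_zero.1 (isSelfAdjoint_eq_zero_of_tr_mul_self (hps.sub ?_) ?_)⟩
  · rw [IsSelfAdjoint, star_rankOne]
  -- The difference is a self-adjoint idempotent of trace zero.
  · have e : (p - rankOne ℂ ψ ψ) * (p - rankOne ℂ ψ ψ) = p - rankOne ℂ ψ ψ := by
      rw [sub_mul, mul_sub, mul_sub, hpp, mul_rankOne, mul_rankOne, rankOne_mul, hps.star_eq, hpψ,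
        InnerProductSpace.rankOne_apply, hψψ, one_smul, sub_self, sub_zero]
    rw [e, map_sub, htr, tr_rankOne, hψψ, sub_self]

/-- The tangent vector at `|ψ⟩⟨ψ|` defined by a vector. -/
noncomputable def tangentOfVector (ψ : H) : H →ₗ[ℝ] Op H where
  toFun θ := rankOne ℂ θ ψ + rankOne ℂ ψ θ
  map_add' x y := by
    simp only [map_add, _root_.add_apply]
    abel
  map_smul' c x := by
    simp [← Complex.coe_smul]

theorem tangentOfVector_apply (ψ θ : H) :
    tangentOfVector ψ θ = rankOne ℂ θ ψ + rankOne ℂ ψ θ := rfl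

theorem tangentOfVector_apply_self {ψ θ : H} (hψ : ‖ψ‖ = 1) (hθ : inner ℂ ψ θ = 0) :
    tangentOfVector ψ θ ψ = θ := by
  have hθψ : inner ℂ θ ψ = 0 := by rw [← inner_conj_symm, hθ, map_zero]
  change inner ℂ ψ ψ • θ + inner ℂ θ ψ • ψ = θ
  rw [hθψ, inner_self_eq_norm_sq_to_K, hψ]
  simp

/-- For `p = |ψ⟩⟨ψ|` the equation `v = vp + pv` recovers `v` from `θ = vψ`, and `pvp = 0` says that
`θ` is orthogonal to `ψ`. -/
theorem mem_tangentSpace_iff_exists_vector {p : PureState H} {ψ : H} (hψ : ‖ψ‖ = 1)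
    (hp : p.op = rankOne ℂ ψ ψ) (v : Op H) :
    v ∈ tangentSpace p ↔ ∃ θ, inner ℂ ψ θ = 0 ∧ tangentOfVector ψ θ = v := by
  have hψψ : inner ℂ ψ ψ = 1 := by rw [inner_self_eq_norm_sq_to_K, hψ]; simp
  rw [mem_tangentSpace_iff]
  constructor
  · rintro ⟨hv, hvp⟩
    have h1 : v = tangentOfVector ψ (v ψ) := by
      conv_lhs => rw [← hvp, hp, mul_rankOne, rankOne_mul, hv.star_eq]
      rfl
    refine ⟨v ψ, ?_, h1.symm⟩
    have h2 : p.op * v * p.op = 0 := mul_tangent_mul p.2.2.1 hvp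
    have h3 := congrArg (fun A : Op H => inner ℂ ψ (A ψ)) h2
    rw [mul_assoc, hp, mul_rankOne, mul_rankOne] at h3
    simpa [hψψ, hψ] using h3
  · rintro ⟨θ, hθ, rfl⟩
    have hθψ : inner ℂ θ ψ = 0 := by rw [← inner_conj_symm, hθ, map_zero]
    refine ⟨?_, ?_⟩
    · rw [IsSelfAdjoint, tangentOfVector_apply, star_add, star_rankOne, star_rankOne, add_comm]
    · rw [hp, tangentOfVector_apply, add_mul, mul_add, mul_rankOne, mul_rankOne, mul_rankOne,
        mul_rankOne]
      simp [hθ, hθψ, hψ]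

/-- The tangent space is a copy of the orthogonal complement of `ψ`, of complex dimension `n - 1`.
-/
theorem finrank_tangentSpace (p : PureState H) :
    Module.finrank ℝ (tangentSpace p) + 2 = 2 * Module.finrank ℂ H := by
  obtain ⟨ψ, hψ, hp⟩ := p.exists_eq_rankOne
  have hψψ : inner ℂ ψ ψ = 1 := by rw [inner_self_eq_norm_sq_to_K, hψ]; simp
  let K : Submodule ℂ H := LinearMap.ker (innerSL ℂ ψ : H →ₗ[ℂ] ℂ)
  have hK : Module.finrank ℂ K + 1 = Module.finrank ℂ H := by
    have h1 := LinearMap.finrank_range_add_finrank_ker (innerSL ℂ ψ : H →ₗ[ℂ] ℂ)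
    have h2 : LinearMap.range (innerSL ℂ ψ : H →ₗ[ℂ] ℂ) = ⊤ := by
      rw [LinearMap.range_eq_top]
      exact fun c => ⟨c • ψ, by
        change inner ℂ ψ (c • ψ) = c
        rw [inner_smul_right, hψψ, mul_one]⟩
    rw [h2, finrank_top, Module.finrank_self] at h1
    change 1 + Module.finrank ℂ K = _ at h1
    omega
  let j : K →ₗ[ℝ] Op H := tangentOfVector ψ ∘ₗ (K.subtype.restrictScalars ℝ)
  have hj : Function.Injective j := by
    rintro ⟨x, hx⟩ ⟨y, hy⟩ hxy
    have h1 := DFunLike.congr_fun hxy ψ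
    change tangentOfVector ψ x ψ = tangentOfVector ψ y ψ at h1
    rw [tangentOfVector_apply_self hψ hx, tangentOfVector_apply_self hψ hy] at h1
    exact Subtype.ext h1
  have hrange : tangentSpace p = LinearMap.range j := by
    ext v
    rw [mem_tangentSpace_iff_exists_vector hψ hp]
    constructor
    · rintro ⟨θ, hθ, rfl⟩
      exact ⟨⟨θ, hθ⟩, rfl⟩
    · rintro ⟨⟨θ, hθ⟩, rfl⟩
      exact ⟨θ, hθ, rfl⟩
  rw [hrange, LinearMap.finrank_range_of_inj hj, finrank_real_of_complex, ← hK]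
  ring

theorem directionsAt_le {L : LieSubalgebra ℝ (Op H)} (hL : L ≤ skewAlgebra H) (p : PureState H) :
    directionsAt L p ≤ tangentSpace p := by
  intro v hv
  obtain ⟨T, hT, rfl⟩ := mem_directionsAt.1 hv
  exact adMap_mem_tangentSpace (hL hT) p

/-- The directions form a subspace of a space of dimension `2n - 2`, so the dimension is right only
if they fill it. The commutator `[T, p]` is the tangent vector of `Tψ`, and imaginary multiples of
`ψ` do not contribute to it; they are the free phase in `IsRayTransitiveAt`. -/
theorem finrank_directionsAt_iff {L : LieSubalgebra ℝ (Op H)} (hL : L ≤ skewAlgebra H)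
    {p : PureState H} {ψ : H} (hψ : ‖ψ‖ = 1) (hp : p.op = rankOne ℂ ψ ψ) :
    (Module.finrank ℝ (directionsAt L p) : ℤ) = 2 * Module.finrank ℂ H - 2 ↔
      IsRayTransitiveAt L ψ := by
  have hfr := finrank_tangentSpace p
  have h1 : (Module.finrank ℝ (directionsAt L p) : ℤ) = 2 * Module.finrank ℂ H - 2 ↔
      directionsAt L p = tangentSpace p := by
    constructor
    · intro h
      exact Submodule.eq_of_le_of_finrank_eq (directionsAt_le hL p) (by omega)
    · intro h
      rw [h]
      omega
  have had : ∀ T ∈ L, adMap T p.op = rankOne ℂ (T ψ) ψ + rankOne ℂ ψ (T ψ) := fun T hT => by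
    have hT' : star T = -T := hL hT
    rw [adMap_apply, hp, mul_rankOne, rankOne_mul, hT', _root_.neg_apply, map_neg, sub_neg_eq_add]
  rw [h1]
  constructor
  · intro h v hv
    have h2 : tangentOfVector ψ v ∈ directionsAt L p := by
      rw [h, mem_tangentSpace_iff_exists_vector hψ hp]
      exact ⟨v, hv, rfl⟩
    obtain ⟨T, hT, hTv⟩ := mem_directionsAt.1 h2
    have h3 : (inner ℂ (T ψ) ψ).re = 0 := by
      have h4 := inner_apply_of_star_eq_neg (hL hT : star T = -T) ψ ψ
      rw [← inner_conj_symm] at h4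
      have h5 := congrArg Complex.re h4
      rw [Complex.conj_re, Complex.neg_re] at h5
      linarith
    -- Applying `[T, p] = |v⟩⟨ψ| + |ψ⟩⟨v|` to `ψ` gives `Tψ + ⟨Tψ, ψ⟩ψ = v`, where the coefficient
    -- is imaginary; this determines the phase.
    refine ⟨T, hT, -(inner ℂ (T ψ) ψ).im, ?_⟩
    have h6 := DFunLike.congr_fun hTv ψ
    rw [had T hT, tangentOfVector_apply_self hψ hv] at h6
    change inner ℂ ψ ψ • T ψ + inner ℂ (T ψ) ψ • ψ = v at h6
    rw [inner_self_eq_norm_sq_to_K, hψ] at h6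
    have h7 : inner ℂ (T ψ) ψ = ((inner ℂ (T ψ) ψ).im : ℂ) * Complex.I := by
      conv_lhs => rw [← Complex.re_add_im (inner ℂ (T ψ) ψ), h3]
      simp
    rw [h7] at h6
    rw [← h6]
    push_cast
    module
  · intro h
    refine le_antisymm (directionsAt_le hL p) fun v hv => ?_
    obtain ⟨θ, hθ, rfl⟩ := (mem_tangentSpace_iff_exists_vector hψ hp v).1 hv
    obtain ⟨T, hT, r, hTr⟩ := h θ hθ
    refine mem_directionsAt.2 ⟨T, hT, ?_⟩
    rw [had T hT, hTr, tangentOfVector_apply]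
    simp only [map_add, _root_.add_apply, map_smul, map_smulₛₗ, _root_.smul_apply, map_mul,
      Complex.conj_ofReal, Complex.conj_I]
    module

end LinearFields

end GeometricQM

/-! ### The controllability criterion -/

theorem theorem5 {H : Type*} [NormedAddCommGroup H] [InnerProductSpace ℂ H]
    [FiniteDimensional ℂ H] (hn : 2 ≤ Module.finrank ℂ H)
    {m : ℕ} (H₀ : GeometricQM.Op H) (Hc : Fin m → GeometricQM.Op H)
    (hH₀ : IsSelfAdjoint H₀) (hHc : ∀ j, IsSelfAdjoint (Hc j))
    (κ : ℝ) (hκ : 0 < κ)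
    (𝒰 : Set (ℝ → Fin m → ℝ))
    (h𝒰 : ∀ u, GeometricQM.IsPiecewiseConstant u → u ∈ 𝒰)
    (h𝒰' : ∀ u ∈ 𝒰, MeasureTheory.LocallyIntegrableOn u (Set.Ici 0))
    (p : GeometricQM.PureState H) :
    FiniteDimensional ℝ (GeometricQM.accessibilityAlgebra κ H₀ Hc) ∧
    (GeometricQM.PureStateControllable 𝒰 H₀ Hc ↔
      (Module.finrank ℝ (GeometricQM.accessibilityAlgebra κ H₀ Hc) : ℤ) -
        Module.finrank ℝ ↥(GeometricQM.accessibilityAlgebra κ H₀ Hc ⊓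
          GeometricQM.vanishingKilling κ p) = 2 * Module.finrank ℂ H - 2) ∧
    ((Module.finrank ℝ (GeometricQM.accessibilityAlgebra κ H₀ Hc) : ℤ) -
        Module.finrank ℝ ↥(GeometricQM.accessibilityAlgebra κ H₀ Hc ⊓
          GeometricQM.vanishingKilling κ p) = 2 * Module.finrank ℂ H - 2 ↔
      (Module.finrank ℝ (GeometricQM.dynamicalAlgebra H₀ Hc) : ℤ) -
        Module.finrank ℝ ↥(GeometricQM.dynamicalAlgebra H₀ Hc ⊓
          GeometricQM.centralizerOf p) = 2 * Module.finrank ℂ H - 2) := by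
  have hL := GeometricQM.dynamicalAlgebra_le_skewAlgebra hH₀ hHc
  obtain ⟨ψ, hψ, hp⟩ := p.exists_eq_rankOne
  have hC := GeometricQM.finrank_accessibilityAlgebra hκ.ne' hH₀ hHc p
  have hD := GeometricQM.finrank_dynamicalAlgebra hH₀ hHc p
  have hC' : (Module.finrank ℝ (GeometricQM.accessibilityAlgebra κ H₀ Hc) : ℤ) -
      Module.finrank ℝ ↥(GeometricQM.accessibilityAlgebra κ H₀ Hc ⊓
        GeometricQM.vanishingKilling κ p) =
      Module.finrank ℝ (GeometricQM.directionsAt (GeometricQM.dynamicalAlgebra H₀ Hc) p) := by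
    rw [hC]
    push_cast
    ring
  have hD' : (Module.finrank ℝ (GeometricQM.dynamicalAlgebra H₀ Hc) : ℤ) -
      Module.finrank ℝ ↥(GeometricQM.dynamicalAlgebra H₀ Hc ⊓ GeometricQM.centralizerOf p) =
      Module.finrank ℝ (GeometricQM.directionsAt (GeometricQM.dynamicalAlgebra H₀ Hc) p) := by
    rw [hD]
    push_cast
    ring
  refine ⟨GeometricQM.finiteDimensional_accessibilityAlgebra hκ.ne' hH₀ hHc, ?_, ?_⟩
  · rw [hC', GeometricQM.finrank_directionsAt_iff hL hψ hp]
    constructor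
    · exact fun h => h.isRayTransitiveAt hn hH₀ hHc h𝒰' hψ
    · intro h
      obtain ⟨φ, hφ, hψφ⟩ := GeometricQM.exists_unit_orthogonal hn ψ
      refine GeometricQM.pureStateControllable_of_transitive hn hH₀ hHc h𝒰 hψ fun v hv =>
        h.exists_apply_eq (fun T hT => hL hT) hψ ⟨φ, hψφ, ?_⟩ hv
      rintro rfl
      simp at hφ
  · rw [hC', hD']
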